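/- Let $C_2>0$, $\rho\in\{1,-1\}$, $L>0$ and $I=[0,L]$. For an integer $m\ge 0$, let $H^m(\mathbb{R})$ be the Sobolev space of complex-valued functions whose weak derivatives up to order $m$ are in $L^2(\mathbb{R})$, with norm $\|u\|_{H^m}^2=\sum_{k\le m}\|D^ku\|_{L^2}^2$. Let $Q\in C(I,H^2(\mathbb{R}))$ be a solution on $I$ of the standard nonlinear Schrödinger equation $$iQ_Z(Z,T)+Q_{TT}(Z,T)+\rho\,|Q(Z,T)|^2Q(Z,T)=0,$$ that is, $Z\mapsto Q(Z,\cdot)$ is differentiable on $I$ (one-sidedly at the endpoints) as an $L^2(\mathbb{R})$-valued function and the equation holds in $L^2(\mathbb{R})$ for every $Z\in I$. Assume that the functions $T\mapsto T^2Q(0,T)$ and $T\mapsto |T|\,Q_T(0,T)$ belong to $L^2(\mathbb{R})$. Put $$Z(z)=\frac{1}{2C_2}\bigl(1-e^{-2C_2z}\bigr)\quad(z\in\mathbb{R}),\qquad \widetilde I=Z^{-1}(I)=\{z\in\mathbb{R}: 0\le Z(z)\le L\}.$$ Then the function $$v(z,t)=e^{\,i\frac{C_2}{4}t^2-\frac{C_2}{2}z}\,Q\bigl(Z(z),e^{-C_2z}t\bigr),\qquad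 z\in\widetilde I,\ t\in\mathbb{R},$$ belongs to $C(\widetilde I,H^2(\mathbb{R}))$. -/

import Mathlib

open MeasureTheory Filter Topology
open scoped ENNReal

noncomputable section

namespace NLSE

/-- `w` is a weak derivative of order `k` of `u` on the real line. -/
def IsWeakDeriv (k : ℕ) (u w : ℝ → ℂ) : Prop :=
  LocallyIntegrable u ∧ LocallyIntegrable w ∧
    ∀ φ : ℝ → ℂ, ContDiff ℝ k φ → HasCompactSupport φ →
      ∫ t, w t * φ t = (-1) ^ k * ∫ t, u t * iteratedDeriv k φ t

open Classical in
/-- The weak derivative of order `k` of `u` (it is unique up to a null set; the value is `0` if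
there is none). -/
def weakDeriv (k : ℕ) (u : ℝ → ℂ) : ℝ → ℂ :=
  if h : ∃ w, IsWeakDeriv k u w then h.choose else 0

/-- `u` (as an a.e. class) belongs to the Sobolev space `H^m(ℝ)`: the weak derivatives of order
`0, …, m` exist and are square integrable. -/
def MemH (m : ℕ) (u : ℝ → ℂ) : Prop :=
  MemLp u 2 volume ∧ ∀ k ≤ m, ∃ w, IsWeakDeriv k u w ∧ MemLp w 2 volume

/-- The norm of `H^m(ℝ)`, `(∑_{k ≤ m} ‖D^k u‖_{L²}²)^{1/2}`. -/
def normH (m : ℕ) (u : ℝ → ℂ) : ℝ≥0∞ :=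
  (∑ k ∈ Finset.range (m + 1), eLpNorm (weakDeriv k u) 2 volume ^ 2) ^ (1 / 2 : ℝ)

/-- The function `z ↦ v(z, ·)` belongs to `C(S, H^m(ℝ))`. -/
def ContinuousIntoH (m : ℕ) (S : Set ℝ) (v : ℝ → ℝ → ℂ) : Prop :=
  (∀ z ∈ S, MemH m (v z)) ∧
    ∀ z₀ ∈ S, Tendsto (fun z => normH m (fun t => v z t - v z₀ t)) (𝓝[S] z₀) (𝓝 0)

/-- `P ∈ L²(ℝ)` is the derivative at `z₀`, within `S`, of the `L²(ℝ)`-valued function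
`z ↦ Q(z, ·)`: the difference quotients converge to `P` in `L²(ℝ)`. -/
def HasL2DerivWithinAt (Q : ℝ → ℝ → ℂ) (P : ℝ → ℂ) (S : Set ℝ) (z₀ : ℝ) : Prop :=
  MemLp P 2 volume ∧
    Tendsto (fun z => eLpNorm (fun t => (Q z t - Q z₀ t) / ((z - z₀ : ℝ) : ℂ) - P t) 2 volume)
      (𝓝[S \ {z₀}] z₀) (𝓝 0)

/-- `Q ∈ C(S, H²(ℝ))` solves `i Q_Z + Q_TT + ρ |Q|² Q = 0` on `S`, as an identity in `L²(ℝ)` for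
every `Z ∈ S`. (The equation itself makes `Q_Z` continuous in `L²(ℝ)`, so `Q ∈ C¹(S, L²(ℝ))`.) -/
def IsH2SolutionSNLSE (ρ : ℝ) (S : Set ℝ) (Q : ℝ → ℝ → ℂ) : Prop :=
  ContinuousIntoH 2 S Q ∧
    ∀ Z ∈ S, ∃ P : ℝ → ℂ, HasL2DerivWithinAt Q P S Z ∧
      ∀ᵐ T : ℝ, Complex.I * P T + weakDeriv 2 (Q Z) T
        + (ρ : ℂ) * ((‖Q Z T‖ ^ 2 : ℝ) : ℂ) * Q Z T = 0

/-- `Z(z) = (1 - e^{-2 C₂ z}) / (2 C₂)`. -/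
def zMap (C₂ z : ℝ) : ℝ := 1 / (2 * C₂) * (1 - Real.exp (-2 * C₂ * z))

/-- `T(z, t) = e^{-C₂ z} t`. -/
def tMap (C₂ z t : ℝ) : ℝ := Real.exp (-C₂ * z) * t

/-- `v(z, t) = e^{i C₂ t² / 4 - C₂ z / 2} Q(Z(z), T(z, t))`. -/
def transformed (C₂ : ℝ) (Q : ℝ → ℝ → ℂ) (z t : ℝ) : ℂ :=
  Complex.exp (Complex.I * ((C₂ / 4 * t ^ 2 : ℝ) : ℂ) - ((C₂ / 2 * z : ℝ) : ℂ))
    * Q (zMap C₂ z) (tMap C₂ z t)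

end NLSE

end

/-! The factor `exp(i C₂ t²/4)` costs one power of `t` per derivative, so with `T = e^{-C₂ z} t` the
derivatives of `v` up to order two are bounded phases and continuous scalars times dilations of `Q`,
`Q_T`, `Q_TT`, `T Q`, `T Q_T` and `T² Q`. Dilations act continuously on `L²`
(`ContinuousIntoL2.comp_dilation`), so it is enough that the three weighted functions are continuous
in `Z` with values in `L²`.

The core is `T² Q`. Replace `T²` by the bounded weight `wt ε = T²/(1 + ε T²)` and differentiate `‖wt
ε · Q(Z)‖²`. The nonlinearity is a real multiple of `Q` and drops out; integrating `Q_TT` by parts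
leaves `‖wt ε · Q‖ ‖wtD ε · Q_T‖` (`abs_re_integral_weight_le`). The interpolation inequality
`l2_weighted_deriv_sq_le` bounds the last factor by `‖Q‖`, `‖wt ε · Q‖` and `‖Q_TT‖`, uniformly in
`ε`. Gronwall then bounds the weighted masses and makes them Lipschitz in `Z`, both uniformly in `ε`
(`exists_weightedMass_bound`). As `ε → 0`, Fatou gives `T² Q(Z) ∈ L²` and the Lipschitz bound makes
its norm continuous, which upgrades the continuity of the truncations to that of `T² Q`.

Interpolation applied to `Q(Z) - Q(Z₀)` yields `T Q_T`, and `T Q` is a bounded multiple of `Q + T²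
Q`. -/

namespace NLSE

/-! ### Calculus of weak derivatives: uniqueness, dilations, smooth multipliers. -/

theorem hasCompactSupport_iteratedDeriv {φ : ℝ → ℂ} (h : HasCompactSupport φ) (k : ℕ) :
    HasCompactSupport (iteratedDeriv k φ) := by
  induction k with
  | zero => simpa using h
  | succ k ih => rw [iteratedDeriv_succ]; exact ih.deriv

theorem integrable_mul_test {f φ : ℝ → ℂ} (hf : LocallyIntegrable f) (hφ : Continuous φ)
    (hc : HasCompactSupport φ) : Integrable (fun t => f t * φ t) :=
  hf.integrable_smul_right_of_hasCompactSupport hφ hc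

theorem integrable_mul_mul_test {f g φ : ℝ → ℂ} (hf : LocallyIntegrable f) (hg : Continuous g)
    (hφ : Continuous φ) (hc : HasCompactSupport φ) : Integrable (fun t => f t * (g t * φ t)) :=
  integrable_mul_test hf (hg.mul hφ) (hc.mul_left (f := g))

theorem ae_eq_of_integral_mul_test_eq {f g : ℝ → ℂ} (hf : LocallyIntegrable f)
    (hg : LocallyIntegrable g)
    (h : ∀ φ : ℝ → ℂ, ContDiff ℝ (⊤ : ℕ∞) φ → HasCompactSupport φ →
      ∫ t, f t * φ t = ∫ t, g t * φ t) : f =ᵐ[volume] g := by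
  refine ae_eq_of_integral_contDiff_smul_eq hf hg fun φ hφ hc => ?_
  have := h (fun t => (φ t : ℂ)) (Complex.ofRealCLM.contDiff.comp hφ)
    (hc.comp_left (g := fun x : ℝ => (x : ℂ)) (by simp))
  simpa only [Complex.real_smul, mul_comm] using this

namespace IsWeakDeriv

variable {k : ℕ} {u u' w w' : ℝ → ℂ}

theorem unique (h : IsWeakDeriv k u w) (h' : IsWeakDeriv k u w') : w =ᵐ[volume] w' :=
  ae_eq_of_integral_mul_test_eq h.2.1 h'.2.1 fun φ hφ hc => by
    have hφ' : ContDiff ℝ k φ := hφ.of_le (by exact_mod_cast le_top)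
    rw [h.2.2 φ hφ' hc, h'.2.2 φ hφ' hc]

theorem weakDeriv_self (h : IsWeakDeriv k u w) : IsWeakDeriv k u (weakDeriv k u) := by
  have : ∃ w, IsWeakDeriv k u w := ⟨w, h⟩
  rw [weakDeriv, dif_pos this]
  exact this.choose_spec

/-- `weakDeriv` is a choice, so every computation with it passes through this a.e. identification
with an explicit representative. -/
theorem weakDeriv_ae (h : IsWeakDeriv k u w) : weakDeriv k u =ᵐ[volume] w :=
  h.weakDeriv_self.unique h

theorem zero_order (h : LocallyIntegrable u) : IsWeakDeriv 0 u u :=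
  ⟨h, h, fun φ _ _ => by simp [iteratedDeriv_zero]⟩

theorem congr (h : IsWeakDeriv k u w) (hu : u =ᵐ[volume] u') (hw : w =ᵐ[volume] w') :
    IsWeakDeriv k u' w' := by
  refine ⟨(locallyIntegrable_congr hu).1 h.1, (locallyIntegrable_congr hw).1 h.2.1,
    fun φ hφ hc => ?_⟩
  have e1 : ∫ t, w' t * φ t = ∫ t, w t * φ t :=
    integral_congr_ae (hw.mono fun t ht => by simp only [ht])
  have e2 : ∫ t, u' t * iteratedDeriv k φ t = ∫ t, u t * iteratedDeriv k φ t :=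
    integral_congr_ae (hu.mono fun t ht => by simp only [ht])
  rw [e1, e2, h.2.2 φ hφ hc]

theorem sub (h : IsWeakDeriv k u w) (h' : IsWeakDeriv k u' w') :
    IsWeakDeriv k (fun t => u t - u' t) (fun t => w t - w' t) := by
  refine ⟨h.1.sub h'.1, h.2.1.sub h'.2.1, fun φ hφ hc => ?_⟩
  have hd : Continuous (iteratedDeriv k φ) := hφ.continuous_iteratedDeriv k le_rfl
  have hdc := hasCompactSupport_iteratedDeriv hc k
  simp only [sub_mul]
  rw [integral_sub (integrable_mul_test h.2.1 hφ.continuous hc)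
      (integrable_mul_test h'.2.1 hφ.continuous hc),
    integral_sub (integrable_mul_test h.1 hd hdc) (integrable_mul_test h'.1 hd hdc),
    h.2.2 φ hφ hc, h'.2.2 φ hφ hc, mul_sub]

theorem const_mul (h : IsWeakDeriv k u w) (c : ℂ) :
    IsWeakDeriv k (fun t => c * u t) (fun t => c * w t) := by
  refine ⟨h.1.continuous_mul continuous_const, h.2.1.continuous_mul continuous_const,
    fun φ hφ hc => ?_⟩
  simp only [mul_assoc, integral_const_mul, h.2.2 φ hφ hc]
  ring

/-- The substitution `s = a t` moves the dilation onto the test function, where each of the `k`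
derivatives produces a factor `a⁻¹`. -/
theorem comp_mul_left (h : IsWeakDeriv k u w) {a : ℝ} (ha : 0 < a) :
    IsWeakDeriv k (fun t => u (a * t)) (fun t => (a : ℂ) ^ k * w (a * t)) := by
  have key : ∀ f : ℝ → ℂ, LocallyIntegrable f → LocallyIntegrable (fun t => f (a * t)) := by
    intro f hf
    rw [locallyIntegrable_iff] at hf ⊢
    intro K hK
    have := hf _ (hK.image (continuous_const_mul a))
    rw [← integrable_indicator_iff (hK.image (continuous_const_mul a)).measurableSet] at this
    rw [← integrable_indicator_iff hK.measurableSet]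
    refine (this.comp_mul_left' ha.ne').congr (ae_of_all _ fun t => ?_)
    show (((fun t => a * t) '' K).indicator f) (a * t) = _
    by_cases ht : t ∈ K
    · rw [Set.indicator_of_mem ht, Set.indicator_of_mem (Set.mem_image_of_mem (a * ·) ht)]
    · rw [Set.indicator_of_notMem ht, Set.indicator_of_notMem]
      rintro ⟨s, hs, hst⟩
      exact ht (mul_left_cancel₀ ha.ne' hst ▸ hs)
  refine ⟨key u h.1, (key w h.2.1).continuous_mul continuous_const, fun φ hφ hc => ?_⟩
  set ψ : ℝ → ℂ := fun s => φ (a⁻¹ * s) with hψ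
  have hψd : ContDiff ℝ k ψ := hφ.comp (contDiff_const.mul contDiff_id)
  have hψc : HasCompactSupport ψ :=
    hc.comp_homeomorph (Homeomorph.mulLeft₀ a⁻¹ (inv_ne_zero ha.ne'))
  have h1 := h.2.2 ψ hψd hψc
  rw [hψ, iteratedDeriv_comp_const_smul hφ] at h1
  have e1 : ∫ t, w (a * t) * φ t = (a⁻¹ : ℝ) • ∫ s, w s * φ (a⁻¹ * s) := by
    have := Measure.integral_comp_mul_left (fun s => w s * φ (a⁻¹ * s)) a
    rw [abs_of_pos (inv_pos.2 ha)] at this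
    rw [← this]
    simp [inv_mul_cancel_left₀ ha.ne']
  have e2 : ∫ t, u (a * t) * iteratedDeriv k φ t
      = (a⁻¹ : ℝ) • ∫ s, u s * iteratedDeriv k φ (a⁻¹ * s) := by
    have := Measure.integral_comp_mul_left (fun s => u s * iteratedDeriv k φ (a⁻¹ * s)) a
    rw [abs_of_pos (inv_pos.2 ha)] at this
    rw [← this]
    simp [inv_mul_cancel_left₀ ha.ne']
  simp only [mul_assoc, integral_const_mul]
  rw [e1, e2, h1]
  simp only [Complex.real_smul, mul_left_comm _ (((a⁻¹ ^ k : ℝ)) : ℂ), integral_const_mul]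
  have : (a : ℂ) ≠ 0 := by exact_mod_cast ha.ne'
  have hp : (a : ℂ) ^ k * ((a⁻¹ ^ k : ℝ) : ℂ) = 1 := by
    push_cast
    rw [← mul_pow, mul_inv_cancel₀ this, one_pow]
  linear_combination ((a⁻¹ : ℝ) : ℂ) * (-1) ^ k *
    (∫ s, u s * iteratedDeriv k φ (a⁻¹ * s)) * hp

theorem mul_smooth_one (h : IsWeakDeriv 1 u w) {g g₁ : ℝ → ℂ} (hg : ∀ t, HasDerivAt g (g₁ t) t)
    (hg₁ : Continuous g₁) :
    IsWeakDeriv 1 (fun t => g t * u t) (fun t => g₁ t * u t + g t * w t) := by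
  have hgc : Continuous g := continuous_iff_continuousAt.2 fun t => (hg t).continuousAt
  have hgd : ContDiff ℝ 1 g := contDiff_one_iff_deriv.2
    ⟨fun t => (hg t).differentiableAt, by rwa [funext fun t => (hg t).deriv]⟩
  refine ⟨h.1.continuous_mul hgc, (h.1.continuous_mul hg₁).add (h.2.1.continuous_mul hgc),
    fun φ hφ hc => ?_⟩
  have hφd : ∀ t, HasDerivAt φ (deriv φ t) t := fun t =>
    (hφ.differentiable (by simp) t).hasDerivAt
  have hφ1 : Continuous (deriv φ) := hφ.continuous_deriv (by simp)
  have h1 := h.2.2 (fun t => g t * φ t) (hgd.mul hφ) (hc.mul_left (f := g))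
  simp only [iteratedDeriv_one, pow_one] at h1 ⊢
  have hd : deriv (fun t => g t * φ t) = fun t => g₁ t * φ t + g t * deriv φ t :=
    funext fun t => ((hg t).mul (hφd t)).deriv
  rw [hd] at h1
  have i1 := integrable_mul_mul_test h.1 hg₁ hφ.continuous hc
  have i2 := integrable_mul_mul_test h.1 hgc hφ1 hc.deriv
  have i3 := integrable_mul_mul_test h.2.1 hgc hφ.continuous hc
  have s1 : ∫ t, u t * (g₁ t * φ t + g t * deriv φ t)
      = (∫ t, u t * (g₁ t * φ t)) + ∫ t, u t * (g t * deriv φ t) := by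
    rw [← integral_add i1 i2]; simp only [mul_add]
  rw [s1] at h1
  have s2 : ∫ t, (g₁ t * u t + g t * w t) * φ t
      = (∫ t, u t * (g₁ t * φ t)) + ∫ t, w t * (g t * φ t) := by
    rw [← integral_add i1 i3]; congr 1; ext t; ring
  rw [s2, h1]
  have s3 : ∫ t, g t * u t * deriv φ t = ∫ t, u t * (g t * deriv φ t) := by
    congr 1; ext t; ring
  rw [s3]; ring

/-- The identity for `w₂` is tested on `g φ` and the one for `w` on `g₁ φ`. Adding the first to
twice the second cancels everything except `∫ u g φ''`. -/
theorem mul_smooth_two {w₂ : ℝ → ℂ} (h : IsWeakDeriv 1 u w) (h2 : IsWeakDeriv 2 u w₂)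
    {g g₁ g₂ : ℝ → ℂ} (hg : ∀ t, HasDerivAt g (g₁ t) t) (hg₁ : ∀ t, HasDerivAt g₁ (g₂ t) t)
    (hg₂ : Continuous g₂) :
    IsWeakDeriv 2 (fun t => g t * u t)
      (fun t => g₂ t * u t + 2 * g₁ t * w t + g t * w₂ t) := by
  have hgc : Continuous g := continuous_iff_continuousAt.2 fun t => (hg t).continuousAt
  have hg1c : Continuous g₁ := continuous_iff_continuousAt.2 fun t => (hg₁ t).continuousAt
  have hg1d : ContDiff ℝ 1 g₁ := contDiff_one_iff_deriv.2
    ⟨fun t => (hg₁ t).differentiableAt, by rwa [funext fun t => (hg₁ t).deriv]⟩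
  have hgd : ContDiff ℝ 2 g := by
    rw [show (2 : WithTop ℕ∞) = 1 + 1 by norm_num, contDiff_succ_iff_deriv]
    exact ⟨fun t => (hg t).differentiableAt, by simp, by rwa [funext fun t => (hg t).deriv]⟩
  refine ⟨h.1.continuous_mul hgc, ((h.1.continuous_mul hg₂).add (h.2.1.continuous_mul
    (continuous_const.mul hg1c))).add (h2.2.1.continuous_mul hgc), fun φ hφ hc => ?_⟩
  have hφ' : ContDiff ℝ 2 φ := by simpa using hφ
  have hφ1 : ContDiff ℝ 1 φ := hφ'.of_le (by norm_num)
  have hdφ : ContDiff ℝ 1 (deriv φ) := by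
    rw [show (2 : WithTop ℕ∞) = 1 + 1 by norm_num, contDiff_succ_iff_deriv] at hφ'
    exact hφ'.2.2
  have hφd : ∀ t, HasDerivAt φ (deriv φ t) t := fun t =>
    (hφ1.differentiable (by simp) t).hasDerivAt
  have hφdd : ∀ t, HasDerivAt (deriv φ) (deriv (deriv φ) t) t := fun t =>
    (hdφ.differentiable (by simp) t).hasDerivAt
  have c0 := hφ.continuous
  have c1 : Continuous (deriv φ) := hdφ.continuous
  have c2 : Continuous (deriv (deriv φ)) := hdφ.continuous_deriv (by simp)
  have e1 := h.2.2 (fun t => g₁ t * φ t) (hg1d.mul hφ1) (hc.mul_left (f := g₁))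
  have e2 := h2.2.2 (fun t => g t * φ t) (hgd.mul hφ') (hc.mul_left (f := g))
  simp only [iteratedDeriv_succ, iteratedDeriv_zero, pow_one,
    even_two.neg_one_pow, one_mul] at e1 e2 ⊢
  have hd1 : deriv (fun t => g₁ t * φ t) = fun t => g₂ t * φ t + g₁ t * deriv φ t :=
    funext fun t => ((hg₁ t).mul (hφd t)).deriv
  have hd : deriv (fun t => g t * φ t) = fun t => g₁ t * φ t + g t * deriv φ t :=
    funext fun t => ((hg t).mul (hφd t)).deriv
  have hdd : deriv (fun t => g₁ t * φ t + g t * deriv φ t) = fun t =>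
      (g₂ t * φ t + g₁ t * deriv φ t) + (g₁ t * deriv φ t + g t * deriv (deriv φ) t) :=
    funext fun t => (((hg₁ t).mul (hφd t)).add ((hg t).mul (hφdd t))).deriv
  rw [hd1] at e1
  rw [hd, hdd] at e2
  have i1 := integrable_mul_mul_test h.1 hg₂ c0 hc
  have i2 := integrable_mul_mul_test h.1 hg1c c1 hc.deriv
  have i3 := integrable_mul_mul_test h.1 hgc c2 hc.deriv.deriv
  have i4 := integrable_mul_mul_test h.2.1 hg1c c0 hc
  have i5 := integrable_mul_mul_test h2.2.1 hgc c0 hc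
  have s1 : ∫ t, u t * (g₂ t * φ t + g₁ t * deriv φ t)
      = (∫ t, u t * (g₂ t * φ t)) + ∫ t, u t * (g₁ t * deriv φ t) := by
    rw [← integral_add i1 i2]; simp only [mul_add]
  have s2 : ∫ t, u t * ((g₂ t * φ t + g₁ t * deriv φ t) +
        (g₁ t * deriv φ t + g t * deriv (deriv φ) t))
      = (∫ t, u t * (g₂ t * φ t)) + 2 * (∫ t, u t * (g₁ t * deriv φ t))
        + ∫ t, u t * (g t * deriv (deriv φ) t) := by
    rw [← integral_const_mul, ← integral_add i1 (i2.const_mul 2), ← integral_add _ i3]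
    · congr 1; ext t; ring
    · exact i1.add (i2.const_mul 2)
  have s3 : ∫ t, (g₂ t * u t + 2 * g₁ t * w t + g t * w₂ t) * φ t
      = (∫ t, u t * (g₂ t * φ t)) + 2 * (∫ t, w t * (g₁ t * φ t))
        + ∫ t, w₂ t * (g t * φ t) := by
    rw [← integral_const_mul, ← integral_add i1 (i4.const_mul 2), ← integral_add _ i5]
    · congr 1; ext t; ring
    · exact i1.add (i4.const_mul 2)
  have s4 : ∫ t, g t * u t * deriv (deriv φ) t = ∫ t, u t * (g t * deriv (deriv φ) t) := by
    congr 1; ext t; ring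
  rw [s3, s4, e1, e2, s1, s2]; ring

end IsWeakDeriv

/-! ### Sobolev functions and convergence in the Sobolev norm. -/

namespace MemH

variable {m : ℕ} {u v : ℝ → ℂ}

theorem isWeakDeriv (h : MemH m u) {k : ℕ} (hk : k ≤ m) : IsWeakDeriv k u (weakDeriv k u) :=
  let ⟨_, hw, _⟩ := h.2 k hk
  hw.weakDeriv_self

theorem memLp_weakDeriv (h : MemH m u) {k : ℕ} (hk : k ≤ m) : MemLp (weakDeriv k u) 2 volume :=
  let ⟨_, hw, hw2⟩ := h.2 k hk
  (memLp_congr_ae hw.weakDeriv_ae).2 hw2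

theorem sub (h : MemH m u) (h' : MemH m v) : MemH m (fun t => u t - v t) :=
  ⟨h.1.sub h'.1, fun _ hk => ⟨_, (h.isWeakDeriv hk).sub (h'.isWeakDeriv hk),
    (h.memLp_weakDeriv hk).sub (h'.memLp_weakDeriv hk)⟩⟩

theorem weakDeriv_sub (h : MemH m u) (h' : MemH m v) {k : ℕ} (hk : k ≤ m) :
    weakDeriv k (fun t => u t - v t) =ᵐ[volume] fun t => weakDeriv k u t - weakDeriv k v t :=
  ((h.isWeakDeriv hk).sub (h'.isWeakDeriv hk)).weakDeriv_ae

end MemH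

theorem tendsto_normH_iff {α : Type*} {l : Filter α} {m : ℕ} {f : α → ℝ → ℂ} :
    Tendsto (fun a => normH m (f a)) l (𝓝 0) ↔
      ∀ k ≤ m, Tendsto (fun a => eLpNorm (weakDeriv k (f a)) 2 volume) l (𝓝 0) := by
  constructor
  · intro h k hk
    refine tendsto_of_tendsto_of_tendsto_of_le_of_le tendsto_const_nhds h (fun _ => zero_le)
      fun a => ?_
    have : eLpNorm (weakDeriv k (f a)) 2 volume
        = (eLpNorm (weakDeriv k (f a)) 2 volume ^ 2) ^ (1 / 2 : ℝ) := by
      rw [← ENNReal.rpow_natCast, ← ENNReal.rpow_mul]; norm_num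
    rw [this]
    exact ENNReal.rpow_le_rpow (Finset.single_le_sum
      (f := fun k => eLpNorm (weakDeriv k (f a)) 2 volume ^ 2) (fun _ _ => zero_le)
      (Finset.mem_range.2 (Nat.lt_succ_of_le hk))) (by norm_num)
  · intro h
    have : Tendsto (fun a => ∑ k ∈ Finset.range (m + 1),
        eLpNorm (weakDeriv k (f a)) 2 volume ^ 2) l (𝓝 0) := by
      have := tendsto_finsetSum (Finset.range (m + 1)) fun k hk =>
        (ENNReal.continuous_pow 2).continuousAt.tendsto.comp
          (h k (Nat.lt_succ_iff.1 (Finset.mem_range.1 hk)))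
      simpa using this
    have h2 := (ENNReal.continuous_rpow_const (y := (1 / 2 : ℝ))).continuousAt.tendsto.comp this
    simpa [Function.comp_def, normH] using h2

/-! ### Primitives, the du Bois-Reymond lemma and `C¹` representatives. -/

theorem intervalIntegrable_of_locallyIntegrable {f : ℝ → ℂ} (hf : LocallyIntegrable f) (a b : ℝ) :
    IntervalIntegrable f volume a b :=
  intervalIntegrable_iff.mpr <|
    (hf.integrableOn_isCompact isCompact_uIcc).mono_set Set.uIoc_subset_uIcc

theorem absolutelyContinuousOnInterval_primitive {f : ℝ → ℂ} {a b : ℝ}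
    (hf : IntervalIntegrable f volume a b) :
    AbsolutelyContinuousOnInterval (fun x => ∫ t in a..x, f t) a b := by
  have hre : IntervalIntegrable (fun t => (f t).re) volume a b :=
    ⟨hf.1.re, hf.2.re⟩
  have him : IntervalIntegrable (fun t => (f t).im) volume a b :=
    ⟨hf.1.im, hf.2.im⟩
  have hc : ∀ c : ℂ, AbsolutelyContinuousOnInterval (fun _ : ℝ => c) a b := fun c =>
    ContDiffOn.absolutelyContinuousOnInterval contDiffOn_const
  have h1 := (hre.absolutelyContinuousOnInterval_intervalIntegral (c := a) (by simp)).smul (hc 1)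
  have h2 := (him.absolutelyContinuousOnInterval_intervalIntegral (c := a) (by simp)).smul
    (hc Complex.I)
  have h3 := h1.add h2
  have key : ∀ x ∈ Set.uIcc a b, ((fun x => ∫ v in a..x, (f v).re) • fun _ : ℝ => (1 : ℂ)) x
      + ((fun x => ∫ v in a..x, (f v).im) • fun _ : ℝ => Complex.I) x = ∫ t in a..x, f t := by
    intro x hx
    have hfx : IntervalIntegrable f volume a x :=
      hf.mono_set (Set.uIcc_subset_uIcc_left hx)
    have hrx : IntervalIntegrable (fun t => (((f t).re : ℝ) : ℂ)) volume a x :=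
      ⟨hfx.1.re.ofReal, hfx.2.re.ofReal⟩
    have hix : IntervalIntegrable (fun t => (((f t).im : ℝ) : ℂ) * Complex.I) volume a x :=
      ⟨hfx.1.im.ofReal.mul_const _, hfx.2.im.ofReal.mul_const _⟩
    simp only [Pi.smul_apply', Complex.real_smul, mul_one]
    rw [← intervalIntegral.integral_ofReal, ← intervalIntegral.integral_ofReal,
      ← intervalIntegral.integral_mul_const, ← intervalIntegral.integral_add hrx hix]
    simp only [Complex.re_add_im]
  -- The two functions agree only on `[a, b]`, but the filter defining absolute continuity sees only
  -- intervals with endpoints there.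
  refine Tendsto.congr' ?_ h3
  filter_upwards [mem_inf_of_right (mem_principal_self _)] with E hE
  refine Finset.sum_congr rfl fun i hi => ?_
  have hE' := hE.1 i hi
  simp only [Pi.add_apply]
  rw [key _ hE'.1, key _ hE'.2]

/-- The primitive `F` is merely absolutely continuous, so the product rule holds only a.e. But `F φ`
minus the primitive of `f φ + F φ'` is absolutely continuous with derivative zero a.e., hence
constant, and `F φ` vanishes at both endpoints. -/
theorem integral_primitive_mul_deriv {f : ℝ → ℂ} (hf : LocallyIntegrable f) (c : ℂ)
    {φ : ℝ → ℂ} (hφ : ContDiff ℝ 1 φ) (hc : HasCompactSupport φ) :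
    ∫ t, (c + ∫ s in (0 : ℝ)..t, f s) * deriv φ t = - ∫ t, f t * φ t := by
  obtain ⟨R, hR⟩ := hc.isCompact.isBounded.subset_closedBall 0
  -- The margin `1` puts both endpoints outside the support of `φ`.
  set a : ℝ := -(|R| + 1)
  set b : ℝ := |R| + 1
  have hab : a ≤ b := by simp only [a, b]; linarith [abs_nonneg R]
  have hz : ∀ t, t ∉ Set.Ioo a b → φ t = 0 := by
    intro t ht
    by_contra h0
    have := hR (subset_tsupport _ h0)
    rw [Metric.mem_closedBall, dist_zero_right, Real.norm_eq_abs] at this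
    refine ht ?_
    have := abs_lt.1 (lt_of_le_of_lt (this.trans (le_abs_self R)) (lt_add_one _))
    exact ⟨this.1, this.2⟩
  have hdz : ∀ t, t ∉ Set.Icc a b → deriv φ t = 0 := by
    intro t ht
    have : φ =ᶠ[𝓝 t] fun _ => 0 := by
      filter_upwards [isClosed_Icc.isOpen_compl.mem_nhds ht] with s hs
      exact hz s fun h => hs (Set.Ioo_subset_Icc_self h)
    rw [this.deriv_eq]; simp
  set F : ℝ → ℂ := fun t => c + ∫ s in (0 : ℝ)..t, f s with hF
  have hi := fun x y => intervalIntegrable_of_locallyIntegrable hf x y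
  have hFc : Continuous F := continuous_const.add (intervalIntegral.continuous_primitive hi 0)
  have hdc : Continuous (deriv φ) := hφ.continuous_deriv (by simp)
  set h : ℝ → ℂ := fun t => f t * φ t + F t * deriv φ t with hh
  have ih1 : LocallyIntegrable (fun t => f t * φ t) := hf.mul_continuous hφ.continuous
  have ih2 : LocallyIntegrable (fun t => F t * deriv φ t) :=
    (hFc.mul hdc).locallyIntegrable
  have ih : LocallyIntegrable h := ih1.add ih2
  have hFac : AbsolutelyContinuousOnInterval F a b := by
    have h1 := absolutelyContinuousOnInterval_primitive (hi a b)
    have h2 : AbsolutelyContinuousOnInterval (fun _ : ℝ => F a) a b :=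
      ContDiffOn.absolutelyContinuousOnInterval contDiffOn_const
    have hFe : F = (fun _ => F a) + fun x => ∫ t in a..x, f t := by
      funext t
      simp only [hF, Pi.add_apply, add_assoc]
      rw [intervalIntegral.integral_add_adjacent_intervals (hi _ _) (hi _ _)]
    rw [hFe]
    exact h2.add h1
  have hφac : AbsolutelyContinuousOnInterval φ a b :=
    ContDiffOn.absolutelyContinuousOnInterval hφ.contDiffOn
  have hG := (hFac.smul hφac).sub (absolutelyContinuousOnInterval_primitive
    (intervalIntegrable_of_locallyIntegrable ih a b))
  obtain ⟨C, hC⟩ := hG.const_of_ae_hasDerivAt_zero (by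
    filter_upwards [LocallyIntegrable.ae_hasDerivAt_integral hf,
      LocallyIntegrable.ae_hasDerivAt_integral ih] with x h1 h2 _
    have d1 : HasDerivAt F (f x) x := (h1 0).const_add c
    have d2 := (d1.mul (hφ.differentiable (by simp) x).hasDerivAt).sub (h2 a)
    simp only [hh, sub_self] at d2
    exact d2)
  have ea := hC a (by simp)
  have eb := hC b (by simp)
  have za : φ a = 0 := hz a (by simp)
  have zb : φ b = 0 := hz b (by simp)
  simp only [Pi.sub_apply, Pi.smul_apply', za, zb, smul_zero,
    intervalIntegral.integral_same, sub_self] at ea eb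
  rw [← ea] at eb
  have e0 : ∫ t in a..b, h t = 0 := by simpa using eb
  have e1 : ∫ t, h t = ∫ t in a..b, h t := by
    rw [intervalIntegral.integral_of_le hab, ← integral_Icc_eq_integral_Ioc,
      setIntegral_eq_integral_of_forall_compl_eq_zero]
    intro t ht
    simp only [hh, hdz t ht, hz t fun h => ht (Set.Ioo_subset_Icc_self h), mul_zero, add_zero]
  have j1 : Integrable (fun t => f t * φ t) := integrable_mul_test hf hφ.continuous hc
  have j2 : Integrable (fun t => F t * deriv φ t) :=
    integrable_mul_test hFc.locallyIntegrable hdc hc.deriv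
  rw [e0] at e1
  rw [hh, integral_add j1 j2] at e1
  exact eq_neg_of_add_eq_zero_right e1

/-- A test function of mean zero is the derivative of a test function, so `f` annihilates it.
Subtracting `(∫ φ) ψ` from an arbitrary `φ`, with `∫ ψ = 1`, gives mean zero and identifies the
constant as `∫ f ψ`. -/
theorem ae_eq_const_of_integral_mul_deriv_eq_zero {f : ℝ → ℂ} (hf : LocallyIntegrable f)
    (h : ∀ φ : ℝ → ℂ, ContDiff ℝ (⊤ : ℕ∞) φ → HasCompactSupport φ → ∫ t, f t * deriv φ t = 0) :
    ∃ c : ℂ, f =ᵐ[volume] fun _ => c := by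
  let B : ContDiffBump (0 : ℝ) := ⟨1, 2, one_pos, one_lt_two⟩
  let ψ : ℝ → ℂ := fun t => (B.normed volume t : ℂ)
  have hψ : ContDiff ℝ (⊤ : ℕ∞) ψ := Complex.ofRealCLM.contDiff.comp B.contDiff_normed
  have hψc : HasCompactSupport ψ :=
    B.hasCompactSupport_normed.comp_left (g := fun x : ℝ => (x : ℂ)) (by simp)
  have hψi : ∫ t, ψ t = 1 := by
    have := B.integral_normed (μ := volume)
    simp only [ψ, integral_complex_ofReal, this, Complex.ofReal_one]
  refine ⟨∫ t, f t * ψ t, 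
    ae_eq_of_integral_mul_test_eq hf (locallyIntegrable_const _) fun φ hφ hc => ?_⟩
  set m : ℂ := ∫ t, φ t
  have iφ : Integrable φ := hφ.continuous.integrable_of_hasCompactSupport hc
  have iψ : Integrable ψ := hψ.continuous.integrable_of_hasCompactSupport hψc
  set η : ℝ → ℂ := fun t => φ t - m * ψ t with hη
  have hηd : ContDiff ℝ (⊤ : ℕ∞) η := hφ.sub (contDiff_const.mul hψ)
  have hηc : HasCompactSupport η := hc.sub (hψc.mul_left (f := fun _ => m))
  have hηi : ∫ t, η t = 0 := by
    rw [hη, integral_sub iφ (iψ.const_mul m), integral_const_mul, hψi, mul_one, sub_self]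
  obtain ⟨R, hR⟩ := hηc.isCompact.isBounded.subset_closedBall 0
  have hz : ∀ t, R < |t| → η t = 0 := by
    intro t ht
    by_contra h0
    have := hR (subset_tsupport _ h0)
    rw [Metric.mem_closedBall, dist_zero_right, Real.norm_eq_abs] at this
    exact absurd ht (not_lt.2 this)
  set χ : ℝ → ℂ := fun t => ∫ s in (-(|R| + 1))..t, η s with hχ
  have hχd : ∀ t, HasDerivAt χ (η t) t := fun t =>
    intervalIntegral.integral_hasDerivAt_right (hηd.continuous.intervalIntegrable _ _)
      (hηd.continuous.stronglyMeasurableAtFilter _ _) hηd.continuous.continuousAt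
  have hχ' : deriv χ = η := funext fun t => (hχd t).deriv
  have hχs : ContDiff ℝ (⊤ : ℕ∞) χ := by
    rw [contDiff_infty_iff_deriv]
    exact ⟨fun t => (hχd t).differentiableAt, hχ' ▸ hηd⟩
  have hχc : HasCompactSupport χ := by
    refine HasCompactSupport.intro (K := Set.Icc (-(|R| + 1)) (|R| + 1)) isCompact_Icc ?_
    intro t ht
    have hR0 := le_abs_self R
    have hR1 := abs_nonneg R
    rcases lt_or_ge t (-(|R| + 1)) with h1 | h1
    · simp only [hχ]
      rw [intervalIntegral.integral_congr (g := fun _ => 0)]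
      · simp
      · intro s hs
        rw [Set.uIcc_of_ge h1.le] at hs
        refine hz s ?_
        rw [abs_of_neg (by linarith [hs.2])]
        linarith [hs.2]
    · have h2 : |R| + 1 < t := by
        by_contra h3
        exact ht ⟨h1, not_lt.1 h3⟩
      simp only [hχ]
      rw [intervalIntegral.integral_of_le h1, setIntegral_eq_integral_of_forall_compl_eq_zero, hηi]
      intro s hs
      refine hz s ?_
      rw [Set.mem_Ioc, not_and_or, not_lt, not_le] at hs
      rcases hs with hs | hs
      · rw [abs_of_neg (by linarith)]; linarith
      · rw [abs_of_pos (by linarith)]; linarith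
  have h1 := h χ hχs hχc
  rw [hχ'] at h1
  have i1 := integrable_mul_test hf hφ.continuous hc
  have i2 := integrable_mul_test hf hψ.continuous hψc
  have h2 : ∫ t, f t * η t = (∫ t, f t * φ t) - m * ∫ t, f t * ψ t := by
    rw [← integral_const_mul, ← integral_sub i1 (i2.const_mul m)]
    congr 1; ext t; simp only [hη]; ring
  rw [h2, sub_eq_zero] at h1
  rw [h1, integral_const_mul, mul_comm]

/-- The du Bois-Reymond lemma. -/
theorem exists_ae_eq_primitive {u w : ℝ → ℂ} (hu : LocallyIntegrable u) (hw : LocallyIntegrable w)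
    (h : ∀ φ : ℝ → ℂ, ContDiff ℝ (⊤ : ℕ∞) φ → HasCompactSupport φ →
      ∫ t, w t * φ t = - ∫ t, u t * deriv φ t) :
    ∃ c : ℂ, u =ᵐ[volume] fun t => c + ∫ s in (0 : ℝ)..t, w s := by
  have hc : Continuous fun t => ∫ s in (0 : ℝ)..t, w s :=
    intervalIntegral.continuous_primitive
      (fun x y => intervalIntegrable_of_locallyIntegrable hw x y) 0
  obtain ⟨c, hc'⟩ := ae_eq_const_of_integral_mul_deriv_eq_zero
    (f := fun t => u t - ∫ s in (0 : ℝ)..t, w s) (hu.sub hc.locallyIntegrable) (by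
      intro φ hφ hφc
      have h1 : ContDiff ℝ 1 φ := hφ.of_le (by exact_mod_cast le_top)
      have hd : Continuous (deriv φ) := h1.continuous_deriv (by simp)
      have e := integral_primitive_mul_deriv hw 0 h1 hφc
      simp only [zero_add] at e
      simp only [sub_mul]
      rw [integral_sub (integrable_mul_test hu hd hφc.deriv)
        (integrable_mul_test hc.locallyIntegrable hd hφc.deriv), e, h φ hφ hφc]
      ring)
  refine ⟨c, ?_⟩
  filter_upwards [hc'] with t ht
  rw [← ht]; ring

/-- A function with locally integrable weak derivatives of orders one and two has a `C¹`
representative, whose derivative can be integrated by parts against `C¹` test functions. -/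
theorem exists_contDiff_representative {u w w₂ : ℝ → ℂ} (h1 : IsWeakDeriv 1 u w)
    (h2 : IsWeakDeriv 2 u w₂) :
    ∃ U W : ℝ → ℂ, u =ᵐ[volume] U ∧ w =ᵐ[volume] W ∧ Continuous W ∧
      (∀ t, HasDerivAt U (W t) t) ∧
      ∀ φ : ℝ → ℂ, ContDiff ℝ 1 φ → HasCompactSupport φ →
        ∫ t, W t * deriv φ t = - ∫ t, w₂ t * φ t := by
  have e1 : ∀ φ : ℝ → ℂ, ContDiff ℝ (⊤ : ℕ∞) φ → HasCompactSupport φ →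
      ∫ t, w t * φ t = - ∫ t, u t * deriv φ t := by
    intro φ hφ hc
    simpa using h1.2.2 φ (hφ.of_le (by exact_mod_cast le_top)) hc
  -- Using `deriv φ` as a test function for `w` shows that `w₂` is the first weak derivative of `w`.
  have e2 : ∀ φ : ℝ → ℂ, ContDiff ℝ (⊤ : ℕ∞) φ → HasCompactSupport φ →
      ∫ t, w₂ t * φ t = - ∫ t, w t * deriv φ t := by
    intro φ hφ hc
    have a1 := h2.2.2 φ (contDiff_infty.1 hφ 2) hc
    have a2 := e1 (deriv φ) (contDiff_infty_iff_deriv.1 hφ).2 hc.deriv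
    simp only [iteratedDeriv_succ, iteratedDeriv_zero, even_two.neg_one_pow, one_mul] at a1
    rw [a1, a2, neg_neg]
  obtain ⟨c, hc⟩ := exists_ae_eq_primitive h1.1 h1.2.1 e1
  obtain ⟨c', hc'⟩ := exists_ae_eq_primitive h1.2.1 h2.2.1 e2
  set W : ℝ → ℂ := fun t => c' + ∫ s in (0 : ℝ)..t, w₂ s with hW
  have hWc : Continuous W := continuous_const.add (intervalIntegral.continuous_primitive
    (fun x y => intervalIntegrable_of_locallyIntegrable h2.2.1 x y) 0)
  refine ⟨fun t => c + ∫ s in (0 : ℝ)..t, W s, W, ?_, hc', hWc, fun t => ?_, fun φ hφ hφc =>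
    integral_primitive_mul_deriv h2.2.1 c' hφ hφc⟩
  · filter_upwards [hc] with t ht
    rw [ht]
    congr 1
    exact intervalIntegral.integral_congr_ae (hc'.mono fun s hs _ => hs)
  · exact (intervalIntegral.integral_hasDerivAt_right (hWc.intervalIntegrable _ _)
      (hWc.stronglyMeasurableAtFilter _ _) hWc.continuousAt).const_add c

/-! ### Real-valued `L²` norms and pairings. -/

/-- The `L²` norm as a real number. -/
noncomputable def l2 (f : ℝ → ℂ) : ℝ := (eLpNorm f 2 volume).toReal

theorem l2_nonneg (f : ℝ → ℂ) : 0 ≤ l2 f := ENNReal.toReal_nonneg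

theorem l2_congr {f g : ℝ → ℂ} (h : f =ᵐ[volume] g) : l2 f = l2 g := by
  rw [l2, l2, eLpNorm_congr_ae h]

theorem l2_eq_norm_toLp {f : ℝ → ℂ} (hf : MemLp f 2 volume) : l2 f = ‖hf.toLp f‖ := by
  rw [Lp.norm_toLp, l2]

theorem l2_add_le {f g : ℝ → ℂ} (hf : MemLp f 2 volume) (hg : MemLp g 2 volume) :
    l2 (fun t => f t + g t) ≤ l2 f + l2 g := by
  rw [l2, l2, l2, ← ENNReal.toReal_add hf.eLpNorm_ne_top hg.eLpNorm_ne_top]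
  exact ENNReal.toReal_mono (ENNReal.add_ne_top.2 ⟨hf.eLpNorm_ne_top, hg.eLpNorm_ne_top⟩)
    (eLpNorm_add_le hf.1 hg.1 (by norm_num))

theorem l2_sub_comm (f g : ℝ → ℂ) : l2 (fun t => f t - g t) = l2 (fun t => g t - f t) := by
  rw [l2, l2]
  exact congrArg _ (eLpNorm_sub_comm f g 2 volume)

theorem l2_le_of_norm_le {f g : ℝ → ℂ} {c : ℝ} (hc : 0 ≤ c) (hg : MemLp g 2 volume)
    (h : ∀ t, ‖f t‖ ≤ c * ‖g t‖) : l2 f ≤ c * l2 g := by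
  have := eLpNorm_le_mul_eLpNorm_of_ae_le_mul (ae_of_all volume h) 2
  rw [l2, l2, ← ENNReal.toReal_ofReal hc, ← ENNReal.toReal_mul]
  exact ENNReal.toReal_mono (ENNReal.mul_ne_top ENNReal.ofReal_ne_top hg.eLpNorm_ne_top) this

theorem integrable_conj_mul {f g : ℝ → ℂ} (hf : MemLp f 2 volume) (hg : MemLp g 2 volume) :
    Integrable (fun t => (starRingEnd ℂ) (f t) * g t) :=
  MemLp.integrable_mul (p := 2) (q := 2) hf.star hg

theorem integral_conj_mul_eq_inner {f g : ℝ → ℂ} (hf : MemLp f 2 volume) (hg : MemLp g 2 volume) :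
    ∫ t, (starRingEnd ℂ) (f t) * g t = inner ℂ (hf.toLp f) (hg.toLp g) := by
  rw [L2.inner_def]
  refine integral_congr_ae ?_
  filter_upwards [hf.coeFn_toLp, hg.coeFn_toLp] with t h1 h2
  rw [h1, h2, RCLike.inner_apply, mul_comm]

theorem norm_integral_conj_mul_le {f g : ℝ → ℂ} (hf : MemLp f 2 volume) (hg : MemLp g 2 volume) :
    ‖∫ t, (starRingEnd ℂ) (f t) * g t‖ ≤ l2 f * l2 g := by
  rw [integral_conj_mul_eq_inner hf hg, l2_eq_norm_toLp hf, l2_eq_norm_toLp hg]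
  exact norm_inner_le_norm _ _

theorem integrable_norm_mul_norm {f g : ℝ → ℂ} (hf : MemLp f 2 volume) (hg : MemLp g 2 volume) :
    Integrable (fun t => ‖f t‖ * ‖g t‖) :=
  MemLp.integrable_mul (p := 2) (q := 2) hf.norm hg.norm

theorem l2_sq {f : ℝ → ℂ} (hf : MemLp f 2 volume) : l2 f ^ 2 = ∫ t, ‖f t‖ ^ 2 := by
  have h1 : ((l2 f ^ 2 : ℝ) : ℂ) = inner ℂ (hf.toLp f) (hf.toLp f) := by
    rw [inner_self_eq_norm_sq_to_K, l2_eq_norm_toLp hf]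
    push_cast; rfl
  rw [← integral_conj_mul_eq_inner hf hf] at h1
  have h2 : ∀ t, (starRingEnd ℂ) (f t) * f t = ((‖f t‖ ^ 2 : ℝ) : ℂ) := fun t => by
    rw [Complex.conj_mul']; push_cast; rfl
  simp only [h2] at h1
  rw [integral_complex_ofReal] at h1
  exact_mod_cast h1

theorem memLp_continuous_mul {f : ℝ → ℂ} (hf : MemLp f 2 volume) {p : ℝ → ℂ} (hp : Continuous p)
    {C : ℝ} (hC : ∀ t, ‖p t‖ ≤ C) : MemLp (fun t => p t * f t) 2 volume :=
  hf.of_le_mul (c := C) (hp.aestronglyMeasurable.mul hf.1) (ae_of_all _ fun t => by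
    rw [norm_mul]; exact mul_le_mul_of_nonneg_right (hC t) (norm_nonneg _))

theorem memLp_ofReal_mul {f : ℝ → ℂ} (hf : MemLp f 2 volume) {p : ℝ → ℝ} (hp : Continuous p)
    {C : ℝ} (hC : ∀ t, |p t| ≤ C) : MemLp (fun t => (p t : ℂ) * f t) 2 volume :=
  memLp_continuous_mul hf (Complex.continuous_ofReal.comp hp) (C := C) fun t => by
    simpa using hC t

/-! ### Weighted integration by parts and interpolation. -/

/-- Integration by parts against a bounded `C¹` weight. -/
theorem integral_weight_conj_mul_weakDeriv_two {u w w₂ : ℝ → ℂ} (h1 : IsWeakDeriv 1 u w)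
    (h2 : IsWeakDeriv 2 u w₂) (hu : MemLp u 2 volume) (hw : MemLp w 2 volume)
    (hw₂ : MemLp w₂ 2 volume) {g g' : ℝ → ℝ} (hg : ∀ t, HasDerivAt g (g' t) t)
    (hg' : Continuous g') {C : ℝ} (hC : ∀ t, |g t| ≤ C) (hC' : ∀ t, |g' t| ≤ C) :
    ∫ t, (starRingEnd ℂ) ((g t : ℂ) * u t) * w₂ t
      = -((∫ t, (starRingEnd ℂ) ((g' t : ℂ) * u t) * w t) +
        ∫ t, (starRingEnd ℂ) ((g t : ℂ) * w t) * w t) := by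
  obtain ⟨U, W, huU, hwW, hWc, hU, hibp⟩ := exists_contDiff_representative h1 h2
  have hgc : Continuous g := continuous_iff_continuousAt.2 fun t => (hg t).continuousAt
  have hUc : Continuous U := continuous_iff_continuousAt.2 fun t => (hU t).continuousAt
  have hU2 : MemLp U 2 volume := (memLp_congr_ae huU).1 hu
  have hW2 : MemLp W 2 volume := (memLp_congr_ae hwW).1 hw
  have hC0 : 0 ≤ C := (abs_nonneg _).trans (hC 0)
  -- `g · conj U` need not have compact support. It is cut off by `B(t / (n + 1))`, whose derivative
  -- is at most `D / (n + 1)`, and `n → ∞` by dominated convergence.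
  let B : ContDiffBump (0 : ℝ) := ⟨1, 2, one_pos, one_lt_two⟩
  have hBd : ContDiff ℝ 1 B := B.contDiff
  have hBc : HasCompactSupport B := B.hasCompactSupport
  have hB1 : ∀ t, HasDerivAt B (deriv B t) t := fun t =>
    (hBd.differentiable (by simp) t).hasDerivAt
  have hBd' : Continuous (deriv B) := hBd.continuous_deriv (by simp)
  obtain ⟨D, hD⟩ := hBc.deriv.exists_bound_of_continuous hBd'
  have hD0 : 0 ≤ D := (norm_nonneg _).trans (hD 0)
  have hBle : ∀ t, |B t| ≤ 1 := fun t => by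
    rw [abs_of_nonneg B.nonneg]; exact B.le_one
  let r : ℕ → ℝ := fun n => ((n : ℝ) + 1)⁻¹
  have hr0 : ∀ n, 0 < r n := fun n => by positivity
  have hr1 : ∀ n, r n ≤ 1 := fun n => inv_le_one_of_one_le₀ (by simp)
  have hrt : Tendsto r atTop (𝓝 0) := by
    have := tendsto_one_div_add_atTop_nhds_zero_nat (𝕜 := ℝ)
    simpa [r, one_div] using this
  let X : ℕ → ℝ → ℝ := fun n t => B (r n * t)
  let X' : ℕ → ℝ → ℝ := fun n t => deriv B (r n * t) * r n
  have hX : ∀ n t, HasDerivAt (X n) (X' n t) t := fun n t => by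
    have : HasDerivAt (fun t => r n * t) (r n) t := by
      simpa using (hasDerivAt_id t).const_mul (r n)
    exact (hB1 (r n * t)).comp t this
  have hXlim : ∀ t, Tendsto (fun n => X n t) atTop (𝓝 1) := fun t => by
    have hc : Tendsto (fun n => r n * t) atTop (𝓝 0) := by simpa using hrt.mul_const t
    have := (hBd.continuous.tendsto 0).comp hc
    have h0 : B 0 = 1 := B.one_of_mem_closedBall (by simp [B])
    rwa [h0] at this
  have hX'le : ∀ n t, |X' n t| ≤ D * r n := fun n t => by
    simp only [X', abs_mul, abs_of_pos (hr0 n)]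
    exact mul_le_mul_of_nonneg_right (hD _) (hr0 n).le
  have hX'lim : ∀ t, Tendsto (fun n => X' n t) atTop (𝓝 0) := fun t =>
    squeeze_zero_norm (fun n => hX'le n t) (by simpa using hrt.const_mul D)
  let φ : ℕ → ℝ → ℂ := fun n t => ((X n t * g t : ℝ) : ℂ) * (starRingEnd ℂ) (U t)
  let φ' : ℕ → ℝ → ℂ := fun n t => ((X' n t * g t + X n t * g' t : ℝ) : ℂ) * (starRingEnd ℂ) (U t)
    + ((X n t * g t : ℝ) : ℂ) * (starRingEnd ℂ) (W t)
  have hφd : ∀ n t, HasDerivAt (φ n) (φ' n t) t := fun n t =>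
    (((hX n t).mul (hg t)).ofReal_comp).mul (hU t).star
  have hcont : ∀ n, Continuous (X n) := fun n => hBd.continuous.comp (continuous_const.mul continuous_id)
  have hcont' : ∀ n, Continuous (X' n) := fun n =>
    (hBd'.comp (continuous_const.mul continuous_id)).mul continuous_const
  have hφ'c : ∀ n, Continuous (φ' n) := fun n =>
    ((Complex.continuous_ofReal.comp (((hcont' n).mul hgc).add ((hcont n).mul hg'))).mul
      (Complex.continuous_conj.comp hUc)).add
      ((Complex.continuous_ofReal.comp ((hcont n).mul hgc)).mul (Complex.continuous_conj.comp hWc))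
  have hφ' : ∀ n, deriv (φ n) = φ' n := fun n => funext fun t => (hφd n t).deriv
  have hφ1 : ∀ n, ContDiff ℝ 1 (φ n) := fun n => contDiff_one_iff_deriv.2
    ⟨fun t => (hφd n t).differentiableAt, by rw [hφ']; exact hφ'c n⟩
  have hφc : ∀ n, HasCompactSupport (φ n) := fun n => by
    have hXc : HasCompactSupport (X n) :=
      hBc.comp_homeomorph (Homeomorph.mulLeft₀ (r n) (hr0 n).ne')
    refine HasCompactSupport.mul_right (f := fun t => ((X n t * g t : ℝ) : ℂ)) ?_
    exact (hXc.mul_right (f' := g)).comp_left (g := fun x : ℝ => (x : ℂ)) (by simp)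
  have hid : ∀ n, ∫ t, W t * φ' n t = - ∫ t, w₂ t * φ n t := fun n => by
    rw [← hφ' n]; exact hibp _ (hφ1 n) (hφc n)
  have hXle : ∀ n t, |X n t| ≤ 1 := fun n t => hBle _
  have hXg : ∀ n t, |X n t * g t| ≤ C := fun n t => by
    rw [abs_mul]
    exact (mul_le_mul (hXle n t) (hC t) (abs_nonneg _) zero_le_one).trans (by simp)
  have hXg' : ∀ n t, |X' n t * g t + X n t * g' t| ≤ D * C + C := fun n t => by
    refine (abs_add_le _ _).trans (add_le_add ?_ ?_)
    · rw [abs_mul]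
      exact mul_le_mul ((hX'le n t).trans (mul_le_of_le_one_right hD0 (hr1 n))) (hC t)
        (abs_nonneg _) hD0
    · rw [abs_mul]
      exact (mul_le_mul (hXle n t) (hC' t) (abs_nonneg _) zero_le_one).trans (by simp)
  have lim1 : Tendsto (fun n => ∫ t, w₂ t * φ n t) atTop
      (𝓝 (∫ t, w₂ t * ((g t : ℂ) * (starRingEnd ℂ) (U t)))) := by
    refine tendsto_integral_of_dominated_convergence (fun t => C * (‖U t‖ * ‖w₂ t‖))
      (fun n => hw₂.1.mul (hφ1 n).continuous.aestronglyMeasurable)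
      ((integrable_norm_mul_norm hU2 hw₂).const_mul C) (fun n => ae_of_all _ fun t => ?_)
      (ae_of_all _ fun t => ?_)
    · simp only [φ, norm_mul, Complex.norm_real, RCLike.norm_conj, Real.norm_eq_abs]
      rw [← abs_mul]
      have := mul_le_mul_of_nonneg_right (hXg n t) (mul_nonneg (norm_nonneg (U t)) (norm_nonneg (w₂ t)))
      calc _ = |X n t * g t| * (‖U t‖ * ‖w₂ t‖) := by ring
        _ ≤ _ := this
    · refine tendsto_const_nhds.mul (Tendsto.mul ?_ tendsto_const_nhds)
      refine (Complex.continuous_ofReal.tendsto _).comp ?_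
      simpa using (hXlim t).mul_const (g t)
  have lim2 : Tendsto (fun n => ∫ t, W t * φ' n t) atTop
      (𝓝 (∫ t, W t * ((g' t : ℂ) * (starRingEnd ℂ) (U t) + (g t : ℂ) * (starRingEnd ℂ) (W t)))) := by
    refine tendsto_integral_of_dominated_convergence
      (fun t => (D * C + C) * (‖U t‖ * ‖W t‖) + C * (‖W t‖ * ‖W t‖))
      (fun n => hW2.1.mul (hφ'c n).aestronglyMeasurable)
      (((integrable_norm_mul_norm hU2 hW2).const_mul _).add
        ((integrable_norm_mul_norm hW2 hW2).const_mul _)) (fun n => ae_of_all _ fun t => ?_)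
      (ae_of_all _ fun t => ?_)
    · have a1 := mul_le_mul_of_nonneg_right (hXg n t)
        (mul_nonneg (norm_nonneg (W t)) (norm_nonneg (W t)))
      have a2 := mul_le_mul_of_nonneg_right (hXg' n t)
        (mul_nonneg (norm_nonneg (U t)) (norm_nonneg (W t)))
      rw [mul_add]
      refine (norm_add_le _ _).trans (add_le_add (le_trans (le_of_eq ?_) a2)
        (le_trans (le_of_eq ?_) a1))
      · simp only [norm_mul, Complex.norm_real, RCLike.norm_conj, Real.norm_eq_abs]; ring
      · simp only [norm_mul, Complex.norm_real, RCLike.norm_conj, Real.norm_eq_abs, abs_mul]; ring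
    · refine tendsto_const_nhds.mul (Tendsto.add (Tendsto.mul ?_ tendsto_const_nhds)
        (Tendsto.mul ?_ tendsto_const_nhds))
      · refine (Complex.continuous_ofReal.tendsto _).comp ?_
        simpa using ((hX'lim t).mul_const (g t)).add ((hXlim t).mul_const (g' t))
      · refine (Complex.continuous_ofReal.tendsto _).comp ?_
        simpa using (hXlim t).mul_const (g t)
  simp only [hid] at lim2
  have hfin := tendsto_nhds_unique lim2 lim1.neg
  have k1 : ∫ t, (starRingEnd ℂ) ((g t : ℂ) * u t) * w₂ t
      = ∫ t, w₂ t * ((g t : ℂ) * (starRingEnd ℂ) (U t)) :=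
    integral_congr_ae (huU.mono fun t ht => by
      simp only [ht, map_mul, Complex.conj_ofReal]; ring)
  have i1 : Integrable fun t => (starRingEnd ℂ) ((g' t : ℂ) * u t) * w t :=
    integrable_conj_mul (memLp_ofReal_mul hu hg' hC') hw
  have i2 : Integrable fun t => (starRingEnd ℂ) ((g t : ℂ) * w t) * w t :=
    integrable_conj_mul (memLp_ofReal_mul hw hgc hC) hw
  rw [k1, eq_neg_iff_add_eq_zero, ← integral_add i1 i2, ← eq_neg_iff_add_eq_zero.1
    (neg_eq_iff_eq_neg.1 hfin.symm), add_right_inj]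
  refine integral_congr_ae ?_
  filter_upwards [huU, hwW] with t h3 h4
  simp only [h3, h4, map_mul, Complex.conj_ofReal]; ring

theorem integral_conj_mul_self {f : ℝ → ℂ} (hf : MemLp f 2 volume) :
    ∫ t, (starRingEnd ℂ) (f t) * f t = ((l2 f ^ 2 : ℝ) : ℂ) := by
  have h2 : ∀ t, (starRingEnd ℂ) (f t) * f t = ((‖f t‖ ^ 2 : ℝ) : ℂ) := fun t => by
    rw [Complex.conj_mul']; push_cast; rfl
  simp only [h2]
  rw [integral_complex_ofReal, l2_sq hf]

/-- Integration by parts with weight `g²` writes `‖g w‖²` through `∫ 2 g g' ū w` and `∫ g² ū w₂`.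
The first integral has one factor `g w` to absorb, and `g² ≤ 4 p` controls the second. The constants
`C` and `C₁` serve integrability only and are absent from the conclusion, which is therefore uniform
over the approximating weights. -/
theorem l2_weighted_deriv_sq_le {u w w₂ : ℝ → ℂ} (h1 : IsWeakDeriv 1 u w)
    (h2 : IsWeakDeriv 2 u w₂) (hu : MemLp u 2 volume) (hw : MemLp w 2 volume)
    (hw₂ : MemLp w₂ 2 volume) {g g' p : ℝ → ℝ} (hg : ∀ t, HasDerivAt g (g' t) t)
    (hg' : Continuous g') {C : ℝ} (hC : ∀ t, |g t| ≤ C) (hC' : ∀ t, |g' t| ≤ 10)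
    (hp : Continuous p) (hgp : ∀ t, g t ^ 2 ≤ 4 * p t) {C₁ : ℝ} (hC₁ : ∀ t, |p t| ≤ C₁) :
    l2 (fun t => (g t : ℂ) * w t) ^ 2
      ≤ 400 * l2 u ^ 2 + 8 * (l2 (fun t => (p t : ℂ) * u t) * l2 w₂) := by
  have hgc : Continuous g := continuous_iff_continuousAt.2 fun t => (hg t).continuousAt
  have hC0 : 0 ≤ C := (abs_nonneg _).trans (hC 0)
  have hG : ∀ t, |g t ^ 2| ≤ C ^ 2 + 20 * C := fun t => by
    rw [abs_pow]
    exact (pow_le_pow_left₀ (abs_nonneg _) (hC t) 2).trans (by linarith)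
  have hG' : ∀ t, |2 * g t * g' t| ≤ C ^ 2 + 20 * C := fun t => by
    rw [abs_mul, abs_mul, abs_two]
    have := mul_le_mul (hC t) (hC' t) (abs_nonneg _) hC0
    nlinarith [sq_nonneg C]
  have key := integral_weight_conj_mul_weakDeriv_two h1 h2 hu hw hw₂ (g := fun t => g t ^ 2)
    (g' := fun t => 2 * g t * g' t) (fun t => by simpa using (hg t).fun_pow 2)
    ((continuous_const.mul hgc).mul hg') hG hG'
  have mgw : MemLp (fun t => (g t : ℂ) * w t) 2 volume := memLp_ofReal_mul hw hgc hC
  have mgu : MemLp (fun t => ((2 * g' t : ℝ) : ℂ) * u t) 2 volume :=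
    memLp_ofReal_mul hu (continuous_const.mul hg') (C := 20) fun t => by
      rw [abs_mul, abs_two]; linarith [hC' t]
  have mGu : MemLp (fun t => ((g t ^ 2 : ℝ) : ℂ) * u t) 2 volume :=
    memLp_ofReal_mul hu (hgc.pow 2) hG
  have mpu : MemLp (fun t => (p t : ℂ) * u t) 2 volume := memLp_ofReal_mul hu hp hC₁
  have e1 : ∫ t, (starRingEnd ℂ) (((g t ^ 2 : ℝ) : ℂ) * w t) * w t
      = ((l2 (fun t => (g t : ℂ) * w t) ^ 2 : ℝ) : ℂ) := by
    rw [← integral_conj_mul_self mgw]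
    congr 1; ext t
    simp only [map_mul, Complex.conj_ofReal]; push_cast; ring
  have e2 : ∫ t, (starRingEnd ℂ) (((2 * g t * g' t : ℝ) : ℂ) * u t) * w t
      = ∫ t, (starRingEnd ℂ) (((2 * g' t : ℝ) : ℂ) * u t) * ((g t : ℂ) * w t) := by
    congr 1; ext t
    simp only [map_mul, Complex.conj_ofReal]; push_cast; ring
  rw [e1, e2] at key
  have b1 := norm_integral_conj_mul_le mgu mgw
  have b2 := norm_integral_conj_mul_le mGu hw₂
  have b3 : l2 (fun t => ((2 * g' t : ℝ) : ℂ) * u t) ≤ 20 * l2 u :=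
    l2_le_of_norm_le (by norm_num) hu fun t => by
      rw [norm_mul, Complex.norm_real, Real.norm_eq_abs, abs_mul, abs_two]
      exact mul_le_mul_of_nonneg_right (by linarith [hC' t]) (norm_nonneg _)
  have b4 : l2 (fun t => ((g t ^ 2 : ℝ) : ℂ) * u t) ≤ 4 * l2 (fun t => (p t : ℂ) * u t) :=
    l2_le_of_norm_le (by norm_num) mpu fun t => by
      rw [norm_mul, norm_mul, Complex.norm_real, Complex.norm_real, Real.norm_eq_abs,
        Real.norm_eq_abs, ← mul_assoc, abs_of_nonneg (sq_nonneg _)]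
      exact mul_le_mul_of_nonneg_right ((hgp t).trans (by linarith [le_abs_self (p t)]))
        (norm_nonneg _)
  set d := l2 (fun t => (g t : ℂ) * w t)
  have hd : 0 ≤ d := l2_nonneg _
  have hn : d ^ 2 ≤ ‖∫ t, (starRingEnd ℂ) (((2 * g' t : ℝ) : ℂ) * u t) * ((g t : ℂ) * w t)‖
      + ‖∫ t, (starRingEnd ℂ) (((g t ^ 2 : ℝ) : ℂ) * u t) * w₂ t‖ := by
    have : ((d ^ 2 : ℝ) : ℂ)
        = -(∫ t, (starRingEnd ℂ) (((2 * g' t : ℝ) : ℂ) * u t) * ((g t : ℂ) * w t))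
        - ∫ t, (starRingEnd ℂ) (((g t ^ 2 : ℝ) : ℂ) * u t) * w₂ t := by
      rw [key]; ring
    have h := norm_sub_le (-(∫ t, (starRingEnd ℂ) (((2 * g' t : ℝ) : ℂ) * u t) * ((g t : ℂ) * w t)))
      (∫ t, (starRingEnd ℂ) (((g t ^ 2 : ℝ) : ℂ) * u t) * w₂ t)
    rwa [← this, norm_neg, Complex.norm_real, Real.norm_of_nonneg (sq_nonneg d)] at h
  have c1 := mul_le_mul_of_nonneg_right b3 hd
  have c2 := mul_le_mul_of_nonneg_right b4 (l2_nonneg w₂)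
  -- Here `d² ≤ 20 ‖u‖ d + 4 ‖p u‖ ‖w₂‖`, and `40 ‖u‖ d ≤ d² + 400 ‖u‖²` absorbs the linear term.
  nlinarith [sq_nonneg (d - 20 * l2 u)]

/-- After integration by parts the term `‖p w‖²` is real, so only the cross term `2 p p' ū w` has an
imaginary part. It is split as `p u` against `p' w`. -/
theorem abs_im_integral_weight_le {u w w₂ : ℝ → ℂ} (h1 : IsWeakDeriv 1 u w)
    (h2 : IsWeakDeriv 2 u w₂) (hu : MemLp u 2 volume) (hw : MemLp w 2 volume)
    (hw₂ : MemLp w₂ 2 volume) {p p' : ℝ → ℝ} (hp : ∀ t, HasDerivAt p (p' t) t)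
    (hp' : Continuous p') {C : ℝ} (hC : ∀ t, |p t| ≤ C) (hC' : ∀ t, |p' t| ≤ C) :
    |(∫ t, (starRingEnd ℂ) (((p t ^ 2 : ℝ) : ℂ) * u t) * w₂ t).im|
      ≤ 2 * (l2 (fun t => (p t : ℂ) * u t) * l2 (fun t => (p' t : ℂ) * w t)) := by
  have hpc : Continuous p := continuous_iff_continuousAt.2 fun t => (hp t).continuousAt
  have hC0 : 0 ≤ C := (abs_nonneg _).trans (hC 0)
  have hG : ∀ t, |p t ^ 2| ≤ 2 * C ^ 2 := fun t => by
    rw [abs_pow]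
    exact (pow_le_pow_left₀ (abs_nonneg _) (hC t) 2).trans (by nlinarith [sq_nonneg C])
  have hG' : ∀ t, |2 * p t * p' t| ≤ 2 * C ^ 2 := fun t => by
    rw [abs_mul, abs_mul, abs_two]
    have := mul_le_mul (hC t) (hC' t) (abs_nonneg _) hC0
    nlinarith [sq_nonneg C]
  have key := integral_weight_conj_mul_weakDeriv_two h1 h2 hu hw hw₂ (g := fun t => p t ^ 2)
    (g' := fun t => 2 * p t * p' t) (fun t => by simpa using (hp t).fun_pow 2)
    ((continuous_const.mul hpc).mul hp') hG hG'
  have mpw : MemLp (fun t => (p t : ℂ) * w t) 2 volume := memLp_ofReal_mul hw hpc hC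
  have mpw' : MemLp (fun t => (p' t : ℂ) * w t) 2 volume := memLp_ofReal_mul hw hp' hC'
  have mpu : MemLp (fun t => (p t : ℂ) * u t) 2 volume := memLp_ofReal_mul hu hpc hC
  have e1 : ∫ t, (starRingEnd ℂ) (((p t ^ 2 : ℝ) : ℂ) * w t) * w t
      = ((l2 (fun t => (p t : ℂ) * w t) ^ 2 : ℝ) : ℂ) := by
    rw [← integral_conj_mul_self mpw]
    congr 1; ext t
    simp only [map_mul, Complex.conj_ofReal]; push_cast; ring
  have e2 : ∫ t, (starRingEnd ℂ) (((2 * p t * p' t : ℝ) : ℂ) * u t) * w t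
      = 2 * ∫ t, (starRingEnd ℂ) ((p t : ℂ) * u t) * ((p' t : ℂ) * w t) := by
    rw [← integral_const_mul]
    congr 1; ext t
    simp only [map_mul, Complex.conj_ofReal]; push_cast; ring
  rw [e1, e2] at key
  rw [key, Complex.neg_im, Complex.add_im, Complex.ofReal_im, add_zero, abs_neg]
  refine (Complex.abs_im_le_norm _).trans ?_
  rw [norm_mul, Complex.norm_ofNat]
  exact mul_le_mul_of_nonneg_left (norm_integral_conj_mul_le mpu mpw') (by norm_num)

/-! ### Differentiating weighted norms along the flow. -/

theorem hasDerivWithinAt_l2_sq {Q : ℝ → ℝ → ℂ} {P : ℝ → ℂ} {S : Set ℝ} {z₀ : ℝ} (hz₀ : z₀ ∈ S)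
    (hQ : ∀ z ∈ S, MemLp (Q z) 2 volume) (h : HasL2DerivWithinAt Q P S z₀)
    {p : ℝ → ℝ} (hp : Continuous p) {C : ℝ} (hC : ∀ t, |p t| ≤ C) :
    HasDerivWithinAt (fun z => l2 (fun t => (p t : ℂ) * Q z t) ^ 2)
      (2 * (∫ t, (starRingEnd ℂ) (((p t ^ 2 : ℝ) : ℂ) * Q z₀ t) * P t).re) S z₀ := by
  classical
  have hC0 : 0 ≤ C := (abs_nonneg _).trans (hC 0)
  have m : ∀ z ∈ S, MemLp (fun t => (p t : ℂ) * Q z t) 2 volume := fun z hz =>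
    memLp_ofReal_mul (hQ z hz) hp hC
  have mP : MemLp (fun t => (p t : ℂ) * P t) 2 volume := memLp_ofReal_mul h.1 hp hC
  -- Lifting to `Lp` makes the inner product rule available; the default `0` is never met on `S`.
  let q : ℝ → Lp ℂ 2 (volume : Measure ℝ) := fun z =>
    if hz : MemLp (fun t => (p t : ℂ) * Q z t) 2 volume then hz.toLp _ else 0
  have hq : ∀ z (hz : z ∈ S), q z = (m z hz).toLp _ := fun z hz => dif_pos (m z hz)
  have hder : HasDerivWithinAt q (mP.toLp _) S z₀ := by
    rw [hasDerivWithinAt_iff_tendsto_slope, tendsto_iff_norm_sub_tendsto_zero]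
    have hlim : Tendsto (fun z => C * l2 (fun t => (Q z t - Q z₀ t) / ((z - z₀ : ℝ) : ℂ) - P t))
        (𝓝[S \ {z₀}] z₀) (𝓝 0) := by
      have := (ENNReal.tendsto_toReal (ENNReal.zero_ne_top)).comp h.2
      simpa [l2, Function.comp_def] using this.const_mul C
    refine squeeze_zero' (Eventually.of_forall fun _ => norm_nonneg _) ?_ hlim
    filter_upwards [self_mem_nhdsWithin] with z hz
    have hd : MemLp (fun t => (Q z t - Q z₀ t) / ((z - z₀ : ℝ) : ℂ) - P t) 2 volume := by
      have := (((hQ z hz.1).sub (hQ z₀ hz₀)).const_mul (((z - z₀ : ℝ) : ℂ)⁻¹)).sub h.1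
      refine (memLp_congr_ae (ae_of_all _ fun t => ?_)).1 this
      simp only [Pi.sub_apply, div_eq_inv_mul]
    rw [slope_def_module, hq z hz.1, hq z₀ hz₀, ← MemLp.toLp_sub, ← MemLp.toLp_const_smul,
      ← MemLp.toLp_sub, ← l2_eq_norm_toLp]
    refine l2_le_of_norm_le hC0 hd fun t => ?_
    have : (((z - z₀)⁻¹ • ((fun t => (p t : ℂ) * Q z t) - fun t => (p t : ℂ) * Q z₀ t))
        - fun t => (p t : ℂ) * P t) t
        = (p t : ℂ) * ((Q z t - Q z₀ t) / ((z - z₀ : ℝ) : ℂ) - P t) := by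
      simp only [Pi.sub_apply, Pi.smul_apply, Complex.real_smul, div_eq_inv_mul]
      push_cast; ring
    rw [this, norm_mul, Complex.norm_real, Real.norm_eq_abs]
    exact mul_le_mul_of_nonneg_right (hC t) (norm_nonneg _)
  have hin := (Complex.reCLM.hasFDerivAt.comp_hasDerivWithinAt z₀ (hder.inner ℂ hder))
  have hval : Complex.reCLM (inner ℂ (q z₀) (mP.toLp _) + inner ℂ (mP.toLp _) (q z₀))
      = 2 * (∫ t, (starRingEnd ℂ) (((p t ^ 2 : ℝ) : ℂ) * Q z₀ t) * P t).re := by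
    rw [← inner_conj_symm (𝕜 := ℂ) (mP.toLp _) (q z₀), hq z₀ hz₀,
      ← integral_conj_mul_eq_inner (m z₀ hz₀) mP]
    have : ∫ t, (starRingEnd ℂ) ((p t : ℂ) * Q z₀ t) * ((p t : ℂ) * P t)
        = ∫ t, (starRingEnd ℂ) (((p t ^ 2 : ℝ) : ℂ) * Q z₀ t) * P t := by
      congr 1; ext t
      simp only [map_mul, Complex.conj_ofReal]; push_cast; ring
    rw [this]
    simp only [Complex.reCLM_apply, Complex.add_re, Complex.conj_re]
    ring
  rw [← hval]
  have heq : ∀ z ∈ S, l2 (fun t => (p t : ℂ) * Q z t) ^ 2 = Complex.reCLM (inner ℂ (q z) (q z)) := by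
    intro z hz
    rw [hq z hz, ← integral_conj_mul_eq_inner (m z hz) (m z hz), integral_conj_mul_self (m z hz),
      Complex.reCLM_apply, Complex.ofReal_re]
  exact hin.congr heq (heq z₀ hz₀)

/-- Along the flow the nonlinear term does not contribute to the growth of weighted `L²` norms. -/
theorem abs_re_integral_weight_le {u w w₂ P : ℝ → ℂ} {ρ : ℝ} (h1 : IsWeakDeriv 1 u w)
    (h2 : IsWeakDeriv 2 u w₂) (hu : MemLp u 2 volume) (hw : MemLp w 2 volume)
    (hw₂ : MemLp w₂ 2 volume) (hP : MemLp P 2 volume)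
    (heq : ∀ᵐ T : ℝ, Complex.I * P T + w₂ T + (ρ : ℂ) * ((‖u T‖ ^ 2 : ℝ) : ℂ) * u T = 0)
    {p p' : ℝ → ℝ} (hp : ∀ t, HasDerivAt p (p' t) t)
    (hp' : Continuous p') {C : ℝ} (hC : ∀ t, |p t| ≤ C) (hC' : ∀ t, |p' t| ≤ C) :
    |(∫ t, (starRingEnd ℂ) (((p t ^ 2 : ℝ) : ℂ) * u t) * P t).re|
      ≤ 2 * (l2 (fun t => (p t : ℂ) * u t) * l2 (fun t => (p' t : ℂ) * w t)) := by
  have hpc : Continuous p := continuous_iff_continuousAt.2 fun t => (hp t).continuousAt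
  have mG : MemLp (fun t => ((p t ^ 2 : ℝ) : ℂ) * u t) 2 volume :=
    memLp_ofReal_mul hu (hpc.pow 2) (C := C ^ 2) fun t => by
      rw [abs_pow]; exact pow_le_pow_left₀ (abs_nonneg _) (hC t) 2
  have hre : (∫ t, (starRingEnd ℂ) (((p t ^ 2 : ℝ) : ℂ) * u t) * P t).re
      = -(∫ t, (starRingEnd ℂ) (((p t ^ 2 : ℝ) : ℂ) * u t) * w₂ t).im := by
    have r1 := integral_re (𝕜 := ℂ) (integrable_conj_mul mG hP)
    have r2 := integral_im (𝕜 := ℂ) (integrable_conj_mul mG hw₂)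
    simp only [RCLike.re_eq_complex_re, RCLike.im_eq_complex_im] at r1 r2
    rw [← r1, ← r2, ← integral_neg]
    refine integral_congr_ae ?_
    filter_upwards [heq] with t ht
    have hPt : P t = Complex.I * w₂ t + Complex.I * ((ρ : ℂ) * ((‖u t‖ ^ 2 : ℝ) : ℂ) * u t) := by
      linear_combination (-Complex.I) * ht + P t * Complex.I_mul_I
    have hc : (starRingEnd ℂ) (u t) * u t = ((‖u t‖ ^ 2 : ℝ) : ℂ) := by
      rw [Complex.conj_mul']; push_cast; rfl
    -- The nonlinear contribution is `I` times a real number at each point. Its real part vanishes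
    -- before integration, so no integrability of `‖u‖⁴` is needed.
    have : (starRingEnd ℂ) (((p t ^ 2 : ℝ) : ℂ) * u t) * P t
        = Complex.I * ((starRingEnd ℂ) (((p t ^ 2 : ℝ) : ℂ) * u t) * w₂ t)
          + Complex.I * ((p t ^ 2 * ρ * ‖u t‖ ^ 2 * ‖u t‖ ^ 2 : ℝ) : ℂ) := by
      rw [hPt]
      simp only [map_mul, Complex.conj_ofReal]
      push_cast at hc ⊢
      linear_combination Complex.I * (p t : ℂ) ^ 2 * ρ * (‖u t‖ : ℂ) ^ 2 * hc
    rw [this, Complex.add_re, Complex.I_mul_re, Complex.I_mul_re, Complex.ofReal_im, neg_zero,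
      add_zero]
  rw [hre, abs_neg]
  exact abs_im_integral_weight_le h1 h2 hu hw hw₂ hp hp' hC hC'

/-! ### Continuous curves in `L²` and their relation to curves in `H^m`. -/

/-- The function `z ↦ F(z, ·)` belongs to `C(S, L²(ℝ))`. -/
def ContinuousIntoL2 (S : Set ℝ) (F : ℝ → ℝ → ℂ) : Prop :=
  (∀ z ∈ S, MemLp (F z) 2 volume) ∧
    ∀ z₀ ∈ S, Tendsto (fun z => l2 (fun t => F z t - F z₀ t)) (𝓝[S] z₀) (𝓝 0)

theorem tendsto_l2_zero_iff {α : Type*} {l : Filter α} {f : α → ℝ → ℂ}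
    (h : ∀ᶠ a in l, MemLp (f a) 2 volume) :
    Tendsto (fun a => l2 (f a)) l (𝓝 0) ↔
      Tendsto (fun a => eLpNorm (f a) 2 volume) l (𝓝 0) := by
  rw [← ENNReal.toReal_zero]
  constructor
  · intro ht
    have := ENNReal.tendsto_ofReal ht
    rw [ENNReal.toReal_zero, ENNReal.ofReal_zero] at this
    refine this.congr' ?_
    filter_upwards [h] with a ha
    exact ENNReal.ofReal_toReal ha.eLpNorm_ne_top
  · exact fun ht => (ENNReal.tendsto_toReal ENNReal.zero_ne_top).comp ht

namespace ContinuousIntoL2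

variable {S : Set ℝ} {F G : ℝ → ℝ → ℂ}

theorem congr (h : ContinuousIntoL2 S F) (hFG : ∀ z ∈ S, F z =ᵐ[volume] G z) :
    ContinuousIntoL2 S G := by
  refine ⟨fun z hz => (memLp_congr_ae (hFG z hz)).1 (h.1 z hz), fun z₀ hz₀ => ?_⟩
  refine (h.2 z₀ hz₀).congr' ?_
  filter_upwards [self_mem_nhdsWithin] with z hz
  exact l2_congr ((hFG z hz).sub (hFG z₀ hz₀))

theorem add (hF : ContinuousIntoL2 S F) (hG : ContinuousIntoL2 S G) :
    ContinuousIntoL2 S (fun z t => F z t + G z t) := by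
  refine ⟨fun z hz => (hF.1 z hz).add (hG.1 z hz), fun z₀ hz₀ => ?_⟩
  refine squeeze_zero' (Eventually.of_forall fun _ => l2_nonneg _) ?_
    (by simpa using (hF.2 z₀ hz₀).add (hG.2 z₀ hz₀))
  filter_upwards [self_mem_nhdsWithin] with z hz
  refine le_trans (le_of_eq ?_) (l2_add_le ((hF.1 z hz).sub (hF.1 z₀ hz₀))
    ((hG.1 z hz).sub (hG.1 z₀ hz₀)))
  congr 1; ext t
  show F z t + G z t - (F z₀ t + G z₀ t) = (F z t - F z₀ t) + (G z t - G z₀ t)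
  ring

theorem weight_mul (hF : ContinuousIntoL2 S F) {p : ℝ → ℂ} (hp : Continuous p) {C : ℝ}
    (hC : ∀ t, ‖p t‖ ≤ C) : ContinuousIntoL2 S (fun z t => p t * F z t) := by
  refine ⟨fun z hz => memLp_continuous_mul (hF.1 z hz) hp hC, fun z₀ hz₀ => ?_⟩
  refine squeeze_zero' (Eventually.of_forall fun _ => l2_nonneg _) ?_
    (by simpa using (hF.2 z₀ hz₀).const_mul C)
  filter_upwards [self_mem_nhdsWithin] with z hz
  refine l2_le_of_norm_le ((norm_nonneg _).trans (hC 0)) ((hF.1 z hz).sub (hF.1 z₀ hz₀)) fun t => ?_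
  rw [← mul_sub, norm_mul]
  exact mul_le_mul_of_nonneg_right (hC t) (norm_nonneg _)

theorem abs_l2_sub_le {f g : ℝ → ℂ} (hf : MemLp f 2 volume) (hg : MemLp g 2 volume) :
    |l2 f - l2 g| ≤ l2 (fun t => f t - g t) := by
  have : l2 (fun t => f t - g t) = ‖hf.toLp f - hg.toLp g‖ := by
    rw [← MemLp.toLp_sub, ← l2_eq_norm_toLp]; rfl
  rw [this, l2_eq_norm_toLp hf, l2_eq_norm_toLp hg]
  exact abs_norm_sub_norm_le _ _

theorem continuousOn_l2 (hF : ContinuousIntoL2 S F) : ContinuousOn (fun z => l2 (F z)) S := by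
  intro z₀ hz₀
  rw [ContinuousWithinAt, tendsto_iff_norm_sub_tendsto_zero]
  refine squeeze_zero' (Eventually.of_forall fun _ => norm_nonneg _) ?_ (hF.2 z₀ hz₀)
  filter_upwards [self_mem_nhdsWithin] with z hz
  exact abs_l2_sub_le (hF.1 z hz) (hF.1 z₀ hz₀)

/-- Continuity of `c(z) F(z, ·)` for a continuous scalar `c`. -/
theorem smul (hF : ContinuousIntoL2 S F) {c : ℝ → ℂ} (hc : ContinuousOn c S) :
    ContinuousIntoL2 S (fun z t => c z * F z t) := by
  have hl : ∀ (a : ℂ) {f : ℝ → ℂ}, MemLp f 2 volume → l2 (fun t => a * f t) ≤ ‖a‖ * l2 f :=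
    fun a f hf => l2_le_of_norm_le (norm_nonneg a) hf fun t => by rw [norm_mul]
  refine ⟨fun z hz => (hF.1 z hz).const_mul (c z), fun z₀ hz₀ => ?_⟩
  have l1 : Tendsto (fun z => ‖c z‖ * l2 (fun t => F z t - F z₀ t)
      + ‖c z - c z₀‖ * l2 (F z₀)) (𝓝[S] z₀) (𝓝 0) := by
    have a1 := (hc z₀ hz₀).tendsto.norm.mul (hF.2 z₀ hz₀)
    have a2 := (tendsto_iff_norm_sub_tendsto_zero.1 (hc z₀ hz₀).tendsto).mul_const (l2 (F z₀))
    simpa using a1.add a2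
  refine squeeze_zero' (Eventually.of_forall fun _ => l2_nonneg _) ?_ l1
  filter_upwards [self_mem_nhdsWithin] with z hz
  have m1 := (hF.1 z hz).sub (hF.1 z₀ hz₀)
  refine le_trans (le_of_eq ?_) ((l2_add_le (m1.const_mul (c z))
    ((hF.1 z₀ hz₀).const_mul (c z - c z₀))).trans (add_le_add (hl _ m1) (hl _ (hF.1 z₀ hz₀))))
  congr 1; ext t; simp only [Pi.sub_apply]; ring

end ContinuousIntoL2

theorem ContinuousIntoH.continuousIntoL2 {m : ℕ} {S : Set ℝ} {v : ℝ → ℝ → ℂ}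
    (h : ContinuousIntoH m S v) {k : ℕ} (hk : k ≤ m) :
    ContinuousIntoL2 S (fun z => weakDeriv k (v z)) := by
  refine ⟨fun z hz => (h.1 z hz).memLp_weakDeriv hk, fun z₀ hz₀ => ?_⟩
  have hm : ∀ᶠ z in 𝓝[S] z₀, MemLp (fun t => weakDeriv k (v z) t - weakDeriv k (v z₀) t) 2 volume := by
    filter_upwards [self_mem_nhdsWithin] with z hz
    exact ((h.1 z hz).memLp_weakDeriv hk).sub ((h.1 z₀ hz₀).memLp_weakDeriv hk)
  rw [tendsto_l2_zero_iff hm]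
  refine (tendsto_normH_iff.1 (h.2 z₀ hz₀) k hk).congr' ?_
  filter_upwards [self_mem_nhdsWithin] with z hz
  exact eLpNorm_congr_ae ((h.1 z hz).weakDeriv_sub (h.1 z₀ hz₀) hk)

theorem ContinuousIntoH.continuousIntoL2_self {m : ℕ} {S : Set ℝ} {v : ℝ → ℝ → ℂ}
    (h : ContinuousIntoH m S v) : ContinuousIntoL2 S v :=
  (h.continuousIntoL2 (Nat.zero_le m)).congr fun z hz =>
    (IsWeakDeriv.zero_order ((h.1 z hz).1.locallyIntegrable (by norm_num))).weakDeriv_ae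

/-- Continuity into `H^m` follows from continuity into `L²` of representatives of the
weak derivatives. -/
theorem continuousIntoH_of_isWeakDeriv {m : ℕ} {S : Set ℝ} {v : ℝ → ℝ → ℂ}
    (h : ∀ k ≤ m, ∃ V : ℝ → ℝ → ℂ, (∀ z ∈ S, IsWeakDeriv k (v z) (V z)) ∧ ContinuousIntoL2 S V) :
    ContinuousIntoH m S v := by
  have hmem : ∀ z ∈ S, MemH m (v z) := by
    intro z hz
    refine ⟨?_, fun k hk => ?_⟩
    · obtain ⟨V, hV, hc⟩ := h 0 (Nat.zero_le m)
      exact (memLp_congr_ae ((IsWeakDeriv.zero_order (hV z hz).1).unique (hV z hz))).2 (hc.1 z hz)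
    · obtain ⟨V, hV, hc⟩ := h k hk
      exact ⟨V z, hV z hz, hc.1 z hz⟩
  refine ⟨hmem, fun z₀ hz₀ => tendsto_normH_iff.2 fun k hk => ?_⟩
  obtain ⟨V, hV, hc⟩ := h k hk
  have hm : ∀ᶠ z in 𝓝[S] z₀, MemLp (fun t => V z t - V z₀ t) 2 volume := by
    filter_upwards [self_mem_nhdsWithin] with z hz
    exact (hc.1 z hz).sub (hc.1 z₀ hz₀)
  refine ((tendsto_l2_zero_iff hm).1 (hc.2 z₀ hz₀)).congr' ?_
  filter_upwards [self_mem_nhdsWithin] with z hz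
  exact eLpNorm_congr_ae ((hV z hz).sub (hV z₀ hz₀)).weakDeriv_ae.symm

/-! ### The truncated weights and their uniform estimates. -/

/-- A bounded approximation of the weight `t²`. -/
noncomputable def wt (ε t : ℝ) : ℝ := t ^ 2 / (1 + ε * t ^ 2)

/-- The derivative of `wt ε`. -/
noncomputable def wtD (ε t : ℝ) : ℝ := 2 * t / (1 + ε * t ^ 2) ^ 2

/-- The second derivative of `wt ε`. -/
noncomputable def wtDD (ε t : ℝ) : ℝ := (2 - 6 * ε * t ^ 2) / (1 + ε * t ^ 2) ^ 3

theorem one_le_wt_den {ε : ℝ} (hε : 0 < ε) (t : ℝ) : 1 ≤ 1 + ε * t ^ 2 := by nlinarith [mul_nonneg hε.le (sq_nonneg t)]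

theorem hasDerivAt_wt {ε : ℝ} (hε : 0 < ε) (t : ℝ) : HasDerivAt (wt ε) (wtD ε t) t := by
  have h0 : 1 + ε * t ^ 2 ≠ 0 := by linarith [one_le_wt_den hε t]
  have h1 : HasDerivAt (fun t : ℝ => t ^ 2) (2 * t) t := by simpa using hasDerivAt_pow 2 t
  have h2 : HasDerivAt (fun t : ℝ => 1 + ε * t ^ 2) (ε * (2 * t)) t := (h1.const_mul ε).const_add 1
  have h3 := h1.fun_div h2 h0
  have e : (2 * t * (1 + ε * t ^ 2) - t ^ 2 * (ε * (2 * t))) / (1 + ε * t ^ 2) ^ 2 = wtD ε t := by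
    unfold wtD
    congr 1
    ring
  rwa [e] at h3

theorem hasDerivAt_wtD {ε : ℝ} (hε : 0 < ε) (t : ℝ) : HasDerivAt (wtD ε) (wtDD ε t) t := by
  have h0 : 1 + ε * t ^ 2 ≠ 0 := by linarith [one_le_wt_den hε t]
  have h1 : HasDerivAt (fun t : ℝ => t ^ 2) (2 * t) t := by simpa using hasDerivAt_pow 2 t
  have h2 : HasDerivAt (fun t : ℝ => 1 + ε * t ^ 2) (ε * (2 * t)) t := (h1.const_mul ε).const_add 1
  have h3 : HasDerivAt (fun t : ℝ => 2 * t) 2 t := by simpa using (hasDerivAt_id t).const_mul 2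
  have h4 := h3.fun_div (h2.fun_pow 2) (pow_ne_zero 2 h0)
  refine h4.congr_deriv ?_
  unfold wtDD
  simp only [Nat.cast_ofNat]
  field_simp
  ring

theorem continuous_wt {ε : ℝ} (hε : 0 < ε) : Continuous (wt ε) :=
  continuous_iff_continuousAt.2 fun t => (hasDerivAt_wt hε t).continuousAt

theorem continuous_wtD {ε : ℝ} (hε : 0 < ε) : Continuous (wtD ε) :=
  continuous_iff_continuousAt.2 fun t => (hasDerivAt_wtD hε t).continuousAt

theorem continuous_wtDD {ε : ℝ} (hε : 0 < ε) : Continuous (wtDD ε) := by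
  refine Continuous.div (by fun_prop) (by fun_prop) fun t => ?_
  have := one_le_wt_den hε t
  positivity

theorem wt_nonneg {ε : ℝ} (hε : 0 < ε) (t : ℝ) : 0 ≤ wt ε t :=
  div_nonneg (sq_nonneg t) (by linarith [one_le_wt_den hε t])

theorem wt_le_sq {ε : ℝ} (hε : 0 < ε) (t : ℝ) : wt ε t ≤ t ^ 2 := div_le_self (sq_nonneg t) (one_le_wt_den hε t)

theorem wt_le_inv {ε : ℝ} (hε : 0 < ε) (t : ℝ) : wt ε t ≤ ε⁻¹ := by
  have h := one_le_wt_den hε t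
  rw [wt, div_le_iff₀ (by linarith)]
  have : ε⁻¹ * (1 + ε * t ^ 2) = ε⁻¹ + t ^ 2 := by field_simp
  rw [this]
  linarith [inv_pos.2 hε]

/-- This is the condition `g² ≤ 4 p` of `l2_weighted_deriv_sq_le` for `g = wtD ε` and `p = wt ε`,
with a constant independent of `ε`. -/
theorem wtD_sq_le {ε : ℝ} (hε : 0 < ε) (t : ℝ) : wtD ε t ^ 2 ≤ 4 * wt ε t := by
  have h := one_le_wt_den hε t
  have h4 : 1 + ε * t ^ 2 ≤ (1 + ε * t ^ 2) ^ 4 := by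
    calc 1 + ε * t ^ 2 = (1 + ε * t ^ 2) ^ 1 := (pow_one _).symm
      _ ≤ _ := pow_le_pow_right₀ h (by norm_num)
  have e1 : wtD ε t ^ 2 = 4 * t ^ 2 / (1 + ε * t ^ 2) ^ 4 := by
    rw [wtD, div_pow, ← pow_mul]; ring
  have e2 : 4 * wt ε t = 4 * t ^ 2 / (1 + ε * t ^ 2) := by rw [wt]; ring
  rw [e1, e2]
  exact div_le_div_of_nonneg_left (by positivity) (by linarith) h4

/-- The same bound also serves `wtD ε`. It blows up as `ε → 0`, which is harmless because it never
enters the uniform estimates. -/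
theorem abs_wt_le {ε : ℝ} (hε : 0 < ε) (t : ℝ) : |wt ε t| ≤ 4 * ε⁻¹ + 1 := by
  rw [abs_of_nonneg (wt_nonneg hε t)]
  linarith [wt_le_inv hε t, inv_pos.2 hε]

theorem abs_wtD_le {ε : ℝ} (hε : 0 < ε) (t : ℝ) : |wtD ε t| ≤ 4 * ε⁻¹ + 1 := by
  have h1 := wtD_sq_le hε t
  have h2 := wt_le_inv hε t
  have h3 := inv_pos.2 hε
  refine abs_le_of_sq_le_sq ?_ (by linarith)
  nlinarith

theorem abs_wtDD_le {ε : ℝ} (hε : 0 < ε) (t : ℝ) : |wtDD ε t| ≤ 10 := by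
  have h := one_le_wt_den hε t
  have h0 : 0 ≤ ε * t ^ 2 := mul_nonneg hε.le (sq_nonneg t)
  have h3 : 1 + ε * t ^ 2 ≤ (1 + ε * t ^ 2) ^ 3 := by
    calc 1 + ε * t ^ 2 = (1 + ε * t ^ 2) ^ 1 := (pow_one _).symm
      _ ≤ _ := pow_le_pow_right₀ h (by norm_num)
  rw [wtDD, abs_div, abs_of_pos (by positivity : 0 < (1 + ε * t ^ 2) ^ 3),
    div_le_iff₀ (by positivity)]
  rw [abs_le]
  constructor <;> nlinarith

theorem tendsto_wt (t : ℝ) :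
    Tendsto (fun n : ℕ => wt (1 / ((n : ℝ) + 1)) t) atTop (𝓝 (t ^ 2)) := by
  have h : Tendsto (fun ε : ℝ => wt ε t) (𝓝 0) (𝓝 (wt 0 t)) := by
    have : ContinuousAt (fun ε : ℝ => wt ε t) 0 := by
      unfold wt
      exact ContinuousAt.div (by fun_prop) (by fun_prop) (by simp)
    exact this
  have := h.comp (tendsto_one_div_add_atTop_nhds_zero_nat (𝕜 := ℝ))
  simpa [wt, Function.comp_def] using this

theorem tendsto_wtD (t : ℝ) :
    Tendsto (fun n : ℕ => wtD (1 / ((n : ℝ) + 1)) t) atTop (𝓝 (2 * t)) := by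
  have h : Tendsto (fun ε : ℝ => wtD ε t) (𝓝 0) (𝓝 (wtD 0 t)) := by
    have : ContinuousAt (fun ε : ℝ => wtD ε t) 0 := by
      unfold wtD
      exact ContinuousAt.div (by fun_prop) (by fun_prop) (by simp)
    exact this
  have := h.comp (tendsto_one_div_add_atTop_nhds_zero_nat (𝕜 := ℝ))
  simpa [wtD, Function.comp_def] using this

/-- Fatou's lemma for `L²` norms. -/
theorem memLp_and_l2_le_of_tendsto {f : ℕ → ℝ → ℂ} {g : ℝ → ℂ} {A : ℝ} (hA : 0 ≤ A)
    (hf : ∀ n, MemLp (f n) 2 volume) (hfA : ∀ n, l2 (f n) ≤ A)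
    (hlim : ∀ᵐ t, Tendsto (fun n => f n t) atTop (𝓝 (g t))) : MemLp g 2 volume ∧ l2 g ≤ A := by
  have h1 : eLpNorm g 2 volume ≤ ENNReal.ofReal A := by
    refine (Lp.eLpNorm_lim_le_liminf_eLpNorm (fun n => (hf n).1) g hlim).trans ?_
    refine (liminf_le_liminf (Eventually.of_forall fun n => ?_)).trans
      (le_of_eq (liminf_const (ENNReal.ofReal A)))
    exact (ENNReal.le_ofReal_iff_toReal_le (hf n).eLpNorm_ne_top hA).2 (hfA n)
  exact ⟨⟨aestronglyMeasurable_of_tendsto_ae atTop (fun n => (hf n).1) hlim,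
    h1.trans_lt ENNReal.ofReal_lt_top⟩, ENNReal.toReal_le_of_le_ofReal hA h1⟩

/-- The interpolation inequality with `g = wtD ε` has a right side bounded uniformly in `ε`. Since
`wtD ε t → 2 t`, Fatou gives the claim. -/
theorem memLp_id_mul_weakDeriv {u w w₂ : ℝ → ℂ} (h1 : IsWeakDeriv 1 u w)
    (h2 : IsWeakDeriv 2 u w₂) (hu : MemLp u 2 volume) (hw : MemLp w 2 volume)
    (hw₂ : MemLp w₂ 2 volume) (hsq : MemLp (fun t : ℝ => (t : ℂ) ^ 2 * u t) 2 volume) :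
    MemLp (fun t : ℝ => (t : ℂ) * w t) 2 volume ∧ l2 (fun t : ℝ => (t : ℂ) * w t)
      ≤ Real.sqrt (400 * l2 u ^ 2 + 8 * (l2 (fun t : ℝ => (t : ℂ) ^ 2 * u t) * l2 w₂)) := by
  set A := Real.sqrt (400 * l2 u ^ 2 + 8 * (l2 (fun t : ℝ => (t : ℂ) ^ 2 * u t) * l2 w₂))
  have hn : ∀ n : ℕ, 0 < 1 / ((n : ℝ) + 1) := fun n => by positivity
  obtain ⟨a1, a2⟩ := memLp_and_l2_le_of_tendsto (A := A) (Real.sqrt_nonneg _)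
    (f := fun n t => (wtD (1 / ((n : ℝ) + 1)) t : ℂ) * w t) (g := fun t => ((2 * t : ℝ) : ℂ) * w t)
    (fun n => memLp_ofReal_mul hw (continuous_wtD (hn n)) (abs_wtD_le (hn n)))
    (fun n => by
      refine Real.le_sqrt_of_sq_le ((l2_weighted_deriv_sq_le h1 h2 hu hw hw₂
        (hasDerivAt_wtD (hn n)) (continuous_wtDD (hn n)) (abs_wtD_le (hn n)) (abs_wtDD_le (hn n))
        (continuous_wt (hn n)) (wtD_sq_le (hn n)) (abs_wt_le (hn n))).trans ?_)
      have : l2 (fun t => (wt (1 / ((n : ℝ) + 1)) t : ℂ) * u t)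
          ≤ 1 * l2 (fun t : ℝ => (t : ℂ) ^ 2 * u t) :=
        l2_le_of_norm_le zero_le_one hsq fun t => by
          rw [one_mul, norm_mul, norm_mul, Complex.norm_real, Real.norm_eq_abs, norm_pow,
            Complex.norm_real, Real.norm_eq_abs, sq_abs, abs_of_nonneg (wt_nonneg (hn n) t)]
          exact mul_le_mul_of_nonneg_right (wt_le_sq (hn n) t) (norm_nonneg _)
      have := mul_le_mul_of_nonneg_right this (l2_nonneg w₂)
      linarith)
    (ae_of_all _ fun t => ((Complex.continuous_ofReal.tendsto _).comp (tendsto_wtD t)).mul_const _)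
  have hle : ∀ t : ℝ, ‖(t : ℂ) * w t‖ ≤ 1 * ‖((2 * t : ℝ) : ℂ) * w t‖ := fun t => by
    rw [one_mul, norm_mul, norm_mul, Complex.norm_real, Complex.norm_real, Real.norm_eq_abs,
      Real.norm_eq_abs, abs_mul, abs_two]
    exact mul_le_mul_of_nonneg_right (by linarith [abs_nonneg t]) (norm_nonneg _)
  exact ⟨a1.of_le_mul (Complex.continuous_ofReal.aestronglyMeasurable.mul hw.1) (ae_of_all _ hle),
    (l2_le_of_norm_le zero_le_one a1 hle).trans (by rw [one_mul]; exact a2)⟩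

/-! ### Propagation of the weights along the flow. -/

/-- The weighted mass `‖wt ε · Q(Z)‖²`. -/
noncomputable def weightedMass (Q : ℝ → ℝ → ℂ) (ε Z : ℝ) : ℝ :=
  l2 (fun t => (wt ε t : ℂ) * Q Z t) ^ 2

section flow

variable {ρ L : ℝ} {Q : ℝ → ℝ → ℂ}

theorem IsH2SolutionSNLSE.exists_bound (hQ : IsH2SolutionSNLSE ρ (Set.Icc 0 L) Q) :
    ∃ M, 0 ≤ M ∧ ∀ Z ∈ Set.Icc 0 L, l2 (Q Z) ≤ M ∧ l2 (weakDeriv 2 (Q Z)) ≤ M := by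
  obtain ⟨M₁, h1⟩ := isCompact_Icc.exists_bound_of_continuousOn
    hQ.1.continuousIntoL2_self.continuousOn_l2
  obtain ⟨M₂, h2⟩ := isCompact_Icc.exists_bound_of_continuousOn
    (hQ.1.continuousIntoL2 le_rfl).continuousOn_l2
  refine ⟨max 0 (max M₁ M₂), le_max_left _ _, fun Z hZ => ⟨?_, ?_⟩⟩
  · exact ((le_abs_self _).trans (h1 Z hZ)).trans ((le_max_left _ _).trans (le_max_right _ _))
  · exact ((le_abs_self _).trans (h2 Z hZ)).trans ((le_max_right _ _).trans (le_max_right _ _))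

theorem IsH2SolutionSNLSE.exists_hasDerivWithinAt_weightedMass
    (hQ : IsH2SolutionSNLSE ρ (Set.Icc 0 L) Q) {M : ℝ}
    (hM : ∀ Z ∈ Set.Icc 0 L, l2 (Q Z) ≤ M ∧ l2 (weakDeriv 2 (Q Z)) ≤ M) {ε : ℝ} (hε : 0 < ε)
    {Z : ℝ} (hZ : Z ∈ Set.Icc 0 L) :
    ∃ N', HasDerivWithinAt (weightedMass Q ε) N' (Set.Icc 0 L) Z ∧
      |N'| ≤ 46 * weightedMass Q ε Z + 42 * M ^ 2 := by
  obtain ⟨P, hP, heq⟩ := hQ.2 Z hZ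
  have hm := hQ.1.1 Z hZ
  have w1 := hm.isWeakDeriv one_le_two
  have w2 := hm.isWeakDeriv le_rfl
  have m1 := hm.memLp_weakDeriv one_le_two
  have m2 := hm.memLp_weakDeriv le_rfl
  refine ⟨_, hasDerivWithinAt_l2_sq hZ (fun z hz => (hQ.1.1 z hz).1) hP (continuous_wt hε)
    (abs_wt_le hε), ?_⟩
  have b1 := abs_re_integral_weight_le w1 w2 hm.1 m1 m2 hP.1 heq (hasDerivAt_wt hε)
    (continuous_wtD hε) (abs_wt_le hε) (abs_wtD_le hε)
  have b2 := l2_weighted_deriv_sq_le w1 w2 hm.1 m1 m2 (hasDerivAt_wtD hε) (continuous_wtDD hε)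
    (abs_wtD_le hε) (abs_wtDD_le hε) (continuous_wt hε) (wtD_sq_le hε) (abs_wt_le hε)
  obtain ⟨c1, c2⟩ := hM Z hZ
  rw [abs_mul, abs_two]
  unfold weightedMass
  set y := l2 (fun t => (wt ε t : ℂ) * Q Z t)
  set d := l2 (fun t => (wtD ε t : ℂ) * weakDeriv 1 (Q Z) t)
  have hy : 0 ≤ y := l2_nonneg _
  have hd : 0 ≤ d := l2_nonneg _
  have hM0 : 0 ≤ M := (l2_nonneg _).trans c1
  have hQ2 : l2 (Q Z) ^ 2 ≤ M ^ 2 := pow_le_pow_left₀ (l2_nonneg _) c1 2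
  have hyM := mul_le_mul_of_nonneg_left c2 hy
  -- From `d² ≤ 400 M² + 8 y M ≤ (21 M + y)²`.
  have hdle : d ≤ 21 * M + y := by
    refine le_of_sq_le_sq ?_ (by positivity)
    nlinarith [mul_nonneg hy hM0, sq_nonneg M, sq_nonneg y]
  have := mul_le_mul_of_nonneg_left hdle hy
  -- `4 y d ≤ 84 M y + 4 y²` and `2 M y ≤ M² + y²` give the constants `46` and `42`.
  nlinarith [sq_nonneg (y - M)]

/-- Gronwall turns the linear differential inequality into the bound `A`. Inserting `A` back bounds
the derivative by `46 A + 42 M²`, which serves as `K`. Neither constant depends on `ε`, as the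
initial mass is at most that of `T² Q(0, T)`. -/
theorem IsH2SolutionSNLSE.exists_weightedMass_bound
    (hQ : IsH2SolutionSNLSE ρ (Set.Icc 0 L) Q)
    (h0 : MemLp (fun T : ℝ => (T : ℂ) ^ 2 * Q 0 T) 2 volume) :
    ∃ A K : ℝ, ∀ ε > 0, (∀ Z ∈ Set.Icc 0 L, weightedMass Q ε Z ≤ A) ∧
      ∀ Z ∈ Set.Icc 0 L, ∀ Z' ∈ Set.Icc 0 L,
        |weightedMass Q ε Z' - weightedMass Q ε Z| ≤ K * |Z' - Z| := by
  obtain ⟨M, hM0, hM⟩ := hQ.exists_bound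
  set δ := l2 (fun T : ℝ => (T : ℂ) ^ 2 * Q 0 T) ^ 2
  set A := gronwallBound δ 46 (42 * M ^ 2) L
  have hbd : ∀ ε > 0, ∀ Z ∈ Set.Icc 0 L, weightedMass Q ε Z ≤ A := by
    intro ε hε Z hZ
    choose! N' hN' hb using fun z (hz : z ∈ Set.Icc 0 L) =>
      hQ.exists_hasDerivWithinAt_weightedMass hM hε hz
    have hnn : ∀ z, ‖weightedMass Q ε z‖ = weightedMass Q ε z := fun z =>
      Real.norm_of_nonneg (sq_nonneg _)
    have hinit : ‖weightedMass Q ε 0‖ ≤ δ := by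
      rw [hnn]
      refine pow_le_pow_left₀ (l2_nonneg _) ?_ 2
      rw [← one_mul (l2 fun T : ℝ => (T : ℂ) ^ 2 * Q 0 T)]
      refine l2_le_of_norm_le zero_le_one h0 fun t => ?_
      rw [one_mul, norm_mul, norm_mul, Complex.norm_real, Real.norm_eq_abs, norm_pow,
        Complex.norm_real, Real.norm_eq_abs, sq_abs, abs_of_nonneg (wt_nonneg hε t)]
      exact mul_le_mul_of_nonneg_right (wt_le_sq hε t) (norm_nonneg _)
    have hg := norm_le_gronwallBound_of_norm_deriv_right_le
      (f := weightedMass Q ε) (f' := N') (δ := δ) (K := 46) (ε := 42 * M ^ 2)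
      (fun z hz => (hN' z hz).continuousWithinAt)
      (fun z hz => (hN' z (Set.Ico_subset_Icc_self hz)).mono_of_mem_nhdsWithin
        (Icc_mem_nhdsGE_of_mem hz)) hinit
      (fun z hz => by rw [hnn]; exact hb z (Set.Ico_subset_Icc_self hz)) Z hZ
    rw [hnn, sub_zero] at hg
    exact hg.trans (gronwallBound_mono (sq_nonneg _) (by positivity) (by norm_num) hZ.2)
  refine ⟨A, 46 * A + 42 * M ^ 2, fun ε hε => ⟨hbd ε hε, fun Z hZ Z' hZ' => ?_⟩⟩
  choose! N' hN' hb using fun z (hz : z ∈ Set.Icc 0 L) =>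
    hQ.exists_hasDerivWithinAt_weightedMass hM hε hz
  exact (convex_Icc 0 L).norm_image_sub_le_of_norm_hasDerivWithin_le hN'
    (fun z hz => (hb z hz).trans (by linarith [hbd ε hε z hz])) hZ hZ'

theorem memLp_sq_mul_of_weightedMass_le {Z A : ℝ} (hQ : MemLp (Q Z) 2 volume)
    (h : ∀ ε > 0, weightedMass Q ε Z ≤ A) :
    MemLp (fun t : ℝ => (t : ℂ) ^ 2 * Q Z t) 2 volume := by
  have hn : ∀ n : ℕ, 0 < 1 / ((n : ℝ) + 1) := fun n => by positivity
  refine (memLp_and_l2_le_of_tendsto (A := Real.sqrt A) (Real.sqrt_nonneg _)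
    (f := fun n t => (wt (1 / ((n : ℝ) + 1)) t : ℂ) * Q Z t)
    (fun n => memLp_ofReal_mul hQ (continuous_wt (hn n)) (abs_wt_le (hn n)))
    (fun n => Real.le_sqrt_of_sq_le (h _ (hn n))) (ae_of_all _ fun t => ?_)).1
  have := ((Complex.continuous_ofReal.tendsto _).comp (tendsto_wt t)).mul_const (Q Z t)
  simpa [Function.comp_def] using this

theorem tendsto_weightedMass {Z : ℝ} (hQ : MemLp (Q Z) 2 volume)
    (h : MemLp (fun t : ℝ => (t : ℂ) ^ 2 * Q Z t) 2 volume) :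
    Tendsto (fun n : ℕ => weightedMass Q (1 / ((n : ℝ) + 1)) Z) atTop
      (𝓝 (l2 (fun t : ℝ => (t : ℂ) ^ 2 * Q Z t) ^ 2)) := by
  have hn : ∀ n : ℕ, 0 < 1 / ((n : ℝ) + 1) := fun n => by positivity
  have hm : ∀ n : ℕ, MemLp (fun t => (wt (1 / ((n : ℝ) + 1)) t : ℂ) * Q Z t) 2 volume := fun n =>
    memLp_ofReal_mul hQ (continuous_wt (hn n)) (abs_wt_le (hn n))
  simp only [weightedMass, l2_sq (hm _), l2_sq h]
  refine tendsto_integral_of_dominated_convergence (fun t : ℝ => ‖(t : ℂ) ^ 2 * Q Z t‖ ^ 2)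
    (fun n => ((hm n).1.norm.pow 2)) (h.integrable_norm_pow (by norm_num)) (fun n => ae_of_all _ fun t => ?_)
    (ae_of_all _ fun t => ?_)
  · rw [Real.norm_of_nonneg (sq_nonneg _)]
    refine pow_le_pow_left₀ (norm_nonneg _) ?_ 2
    rw [norm_mul, norm_mul, Complex.norm_real, Real.norm_eq_abs, norm_pow,
      Complex.norm_real, Real.norm_eq_abs, sq_abs, abs_of_nonneg (wt_nonneg (hn n) t)]
    exact mul_le_mul_of_nonneg_right (wt_le_sq (hn n) t) (norm_nonneg _)
  · have := ((Complex.continuous_ofReal.tendsto _).comp (tendsto_wt t)).mul_const (Q Z t)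
    have := (this.norm).pow 2
    simpa [Function.comp_def] using this

/-- Since `0 ≤ wt ε t ≤ t²`, one has `(t² - wt)² ≤ t⁴ - wt²`. Hence the truncation error is
controlled by a difference of squared norms, whose dependence on `Z` is continuous. -/
theorem l2_sq_sub_wt_sq_le {Z ε : ℝ} (hε : 0 < ε) (hQ : MemLp (Q Z) 2 volume)
    (h : MemLp (fun t : ℝ => (t : ℂ) ^ 2 * Q Z t) 2 volume) :
    l2 (fun t : ℝ => (t : ℂ) ^ 2 * Q Z t - (wt ε t : ℂ) * Q Z t) ^ 2
      ≤ l2 (fun t : ℝ => (t : ℂ) ^ 2 * Q Z t) ^ 2 - weightedMass Q ε Z := by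
  have hm : MemLp (fun t => (wt ε t : ℂ) * Q Z t) 2 volume :=
    memLp_ofReal_mul hQ (continuous_wt hε) (abs_wt_le hε)
  have hd : MemLp (fun t : ℝ => (t : ℂ) ^ 2 * Q Z t - (wt ε t : ℂ) * Q Z t) 2 volume := h.sub hm
  have i1 : Integrable (fun t : ℝ => ‖(t : ℂ) ^ 2 * Q Z t‖ ^ 2) := h.integrable_norm_pow (by norm_num)
  have i2 : Integrable (fun t : ℝ => ‖(wt ε t : ℂ) * Q Z t‖ ^ 2) := hm.integrable_norm_pow (by norm_num)
  have i3 : Integrable (fun t : ℝ => ‖(t : ℂ) ^ 2 * Q Z t - (wt ε t : ℂ) * Q Z t‖ ^ 2) :=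
    hd.integrable_norm_pow (by norm_num)
  rw [weightedMass, l2_sq h, l2_sq hm, l2_sq hd, ← integral_sub i1 i2]
  refine integral_mono i3 (i1.sub i2) fun t => ?_
  have e : (t : ℂ) ^ 2 * Q Z t - (wt ε t : ℂ) * Q Z t = ((t ^ 2 - wt ε t : ℝ) : ℂ) * Q Z t := by
    push_cast; ring
  have e2 : (t : ℂ) ^ 2 * Q Z t = ((t ^ 2 : ℝ) : ℂ) * Q Z t := by push_cast; ring
  simp only [e]
  rw [e2]
  simp only [norm_mul, Complex.norm_real, mul_pow, Real.norm_eq_abs, sq_abs]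
  have a1 := wt_nonneg hε t
  have a2 := wt_le_sq hε t
  have : (t ^ 2 - wt ε t) ^ 2 ≤ (t ^ 2) ^ 2 - wt ε t ^ 2 := by nlinarith
  rw [← sub_mul]
  exact mul_le_mul_of_nonneg_right this (sq_nonneg _)

/-- The weight `T²` propagates along the flow, continuously in `L²`. -/
theorem IsH2SolutionSNLSE.continuousIntoL2_sq_mul
    (hQ : IsH2SolutionSNLSE ρ (Set.Icc 0 L) Q)
    (h0 : MemLp (fun T : ℝ => (T : ℂ) ^ 2 * Q 0 T) 2 volume) :
    ContinuousIntoL2 (Set.Icc 0 L) (fun Z (t : ℝ) => (t : ℂ) ^ 2 * Q Z t) := by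
  obtain ⟨A, K, hAK⟩ := hQ.exists_weightedMass_bound h0
  have hm0 : ∀ Z ∈ Set.Icc 0 L, MemLp (Q Z) 2 volume := fun Z hZ => (hQ.1.1 Z hZ).1
  have hm : ∀ Z ∈ Set.Icc 0 L, MemLp (fun t : ℝ => (t : ℂ) ^ 2 * Q Z t) 2 volume := fun Z hZ =>
    memLp_sq_mul_of_weightedMass_le (hm0 Z hZ) fun ε hε => (hAK ε hε).1 Z hZ
  refine ⟨hm, fun Z₀ hZ₀ => ?_⟩
  set X : ℝ → ℝ := fun Z => l2 (fun t : ℝ => (t : ℂ) ^ 2 * Q Z t) ^ 2 with hX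
  have hn : ∀ n : ℕ, 0 < 1 / ((n : ℝ) + 1) := fun n => by positivity
  have hsq : ∀ f : ℝ → ℝ, (∀ Z ∈ Set.Icc 0 L, |f Z - f Z₀| ≤ K * |Z - Z₀|) →
      Tendsto f (𝓝[Set.Icc 0 L] Z₀) (𝓝 (f Z₀)) := by
    intro f hf
    rw [tendsto_iff_norm_sub_tendsto_zero]
    have hl : Tendsto (fun Z => K * |Z - Z₀|) (𝓝[Set.Icc 0 L] Z₀) (𝓝 0) := by
      have : Continuous fun Z => K * |Z - Z₀| := by fun_prop
      simpa using (this.tendsto Z₀).mono_left nhdsWithin_le_nhds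
    refine squeeze_zero' (Eventually.of_forall fun _ => norm_nonneg _) ?_ hl
    filter_upwards [self_mem_nhdsWithin] with Z hZ
    exact hf Z hZ
  -- The Lipschitz bound is uniform in the truncation, so it survives the limit.
  have hXt : Tendsto X (𝓝[Set.Icc 0 L] Z₀) (𝓝 (X Z₀)) := hsq X fun Z hZ =>
    le_of_tendsto (((tendsto_weightedMass (hm0 Z hZ) (hm Z hZ)).sub
      (tendsto_weightedMass (hm0 Z₀ hZ₀) (hm Z₀ hZ₀))).abs)
      (Eventually.of_forall fun n => (hAK _ (hn n)).2 Z₀ hZ₀ Z hZ)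
  rw [Metric.tendsto_nhds]
  intro η hη
  have hη3 : 0 < η / 3 := by linarith
  -- The truncation is fixed at `Z₀` alone; by continuity of both masses the same `n` works for `Z`
  -- near `Z₀`.
  obtain ⟨n, hnη⟩ : ∃ n : ℕ, X Z₀ - weightedMass Q (1 / ((n : ℝ) + 1)) Z₀ < (η / 3) ^ 2 := by
    have := (tendsto_const_nhds (x := X Z₀)).sub (tendsto_weightedMass (hm0 Z₀ hZ₀) (hm Z₀ hZ₀))
    simp only [hX, sub_self] at this
    exact (this.eventually (gt_mem_nhds (by positivity : (0 : ℝ) < (η / 3) ^ 2))).exists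
  set ε : ℝ := 1 / ((n : ℝ) + 1)
  have hε : 0 < ε := hn n
  have t1 : ∀ᶠ Z in 𝓝[Set.Icc 0 L] Z₀, X Z - weightedMass Q ε Z < (η / 3) ^ 2 :=
    (hXt.sub (hsq (weightedMass Q ε) fun Z hZ => (hAK ε hε).2 Z₀ hZ₀ Z hZ)).eventually
      (gt_mem_nhds hnη)
  have t2 := ((hQ.1.continuousIntoL2_self.weight_mul
    (Complex.continuous_ofReal.comp (continuous_wt hε)) (C := 4 * ε⁻¹ + 1)
    (fun t => by simpa using abs_wt_le hε t)).2 Z₀ hZ₀).eventually (gt_mem_nhds hη3)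
  filter_upwards [t1, t2, self_mem_nhdsWithin] with Z h1 h2 hZ
  rw [Real.dist_eq, sub_zero, abs_of_nonneg (l2_nonneg _)]
  have e1 : ∀ Z ∈ Set.Icc 0 L, X Z - weightedMass Q ε Z < (η / 3) ^ 2 →
      l2 (fun t : ℝ => (t : ℂ) ^ 2 * Q Z t - (wt ε t : ℂ) * Q Z t) < η / 3 := fun Z hZ h =>
    lt_of_pow_lt_pow_left₀ 2 hη3.le
      ((l2_sq_sub_wt_sq_le hε (hm0 Z hZ) (hm Z hZ)).trans_lt h)
  have f1 := e1 Z hZ h1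
  have f2 := e1 Z₀ hZ₀ hnη
  rw [l2_sub_comm] at f2
  have mw : ∀ Z ∈ Set.Icc 0 L, MemLp (fun t => (wt ε t : ℂ) * Q Z t) 2 volume := fun Z hZ =>
    memLp_ofReal_mul (hm0 Z hZ) (continuous_wt hε) (abs_wt_le hε)
  have g1 := l2_add_le (((hm Z hZ).sub (mw Z hZ)).add ((mw Z hZ).sub (mw Z₀ hZ₀)))
    ((mw Z₀ hZ₀).sub (hm Z₀ hZ₀))
  have g2 := l2_add_le ((hm Z hZ).sub (mw Z hZ)) ((mw Z hZ).sub (mw Z₀ hZ₀))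
  have e : (fun t : ℝ => (t : ℂ) ^ 2 * Q Z t - (t : ℂ) ^ 2 * Q Z₀ t)
      = fun t : ℝ => (((t : ℂ) ^ 2 * Q Z t - (wt ε t : ℂ) * Q Z t)
        + ((wt ε t : ℂ) * Q Z t - (wt ε t : ℂ) * Q Z₀ t))
        + ((wt ε t : ℂ) * Q Z₀ t - (t : ℂ) ^ 2 * Q Z₀ t) := by
    funext t; ring
  rw [e]
  refine g1.trans_lt ((add_le_add_left g2 _).trans_lt ?_)
  have : η = η / 3 + η / 3 + η / 3 := by ring
  rw [this]
  exact add_lt_add (add_lt_add f1 h2) f2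

/-- Interpolation needs only membership in `H²` and the weight `t²`, not the equation, so it applies
to `Q(Z) - Q(Z₀)`, for which its right side tends to zero. -/
theorem IsH2SolutionSNLSE.continuousIntoL2_id_mul_weakDeriv
    (hQ : IsH2SolutionSNLSE ρ (Set.Icc 0 L) Q)
    (h0 : MemLp (fun T : ℝ => (T : ℂ) ^ 2 * Q 0 T) 2 volume) :
    ContinuousIntoL2 (Set.Icc 0 L) (fun Z (t : ℝ) => (t : ℂ) * weakDeriv 1 (Q Z) t) := by
  have hs := hQ.continuousIntoL2_sq_mul h0
  have hint := fun (u : ℝ → ℂ) (hu : MemH 2 u) => memLp_id_mul_weakDeriv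
    (hu.isWeakDeriv one_le_two) (hu.isWeakDeriv le_rfl) hu.1 (hu.memLp_weakDeriv one_le_two)
    (hu.memLp_weakDeriv le_rfl)
  refine ⟨fun Z hZ => (hint _ (hQ.1.1 Z hZ) (hs.1 Z hZ)).1, fun Z₀ hZ₀ => ?_⟩
  have l1 := hQ.1.continuousIntoL2_self.2 Z₀ hZ₀
  have l2' := hs.2 Z₀ hZ₀
  have l3 := (hQ.1.continuousIntoL2 le_rfl).2 Z₀ hZ₀
  have hlim := (((l1.pow 2).const_mul 400).add ((l2'.mul l3).const_mul 8)).sqrt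
  simp only [ne_eq, OfNat.ofNat_ne_zero, not_false_eq_true, zero_pow, mul_zero, add_zero,
    Real.sqrt_zero] at hlim
  refine squeeze_zero' (Eventually.of_forall fun _ => l2_nonneg _) ?_ hlim
  filter_upwards [self_mem_nhdsWithin] with Z hZ
  have hD := (hQ.1.1 Z hZ).sub (hQ.1.1 Z₀ hZ₀)
  have hDs : (fun t : ℝ => (t : ℂ) ^ 2 * (Q Z t - Q Z₀ t))
      = fun t : ℝ => (t : ℂ) ^ 2 * Q Z t - (t : ℂ) ^ 2 * Q Z₀ t := by funext t; ring
  have h := (hint _ hD (by rw [hDs]; exact (hs.1 Z hZ).sub (hs.1 Z₀ hZ₀))).2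
  rw [hDs, l2_congr ((hQ.1.1 Z hZ).weakDeriv_sub (hQ.1.1 Z₀ hZ₀) le_rfl)] at h
  refine le_trans (le_of_eq (l2_congr ?_)) h
  filter_upwards [(hQ.1.1 Z hZ).weakDeriv_sub (hQ.1.1 Z₀ hZ₀) one_le_two] with t ht
  rw [ht]; ring

/-- `t Q = (t / (1 + t²)) (Q + t² Q)`, and the multiplier is bounded by `1`. -/
theorem IsH2SolutionSNLSE.continuousIntoL2_id_mul
    (hQ : IsH2SolutionSNLSE ρ (Set.Icc 0 L) Q)
    (h0 : MemLp (fun T : ℝ => (T : ℂ) ^ 2 * Q 0 T) 2 volume) :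
    ContinuousIntoL2 (Set.Icc 0 L) (fun Z (t : ℝ) => (t : ℂ) * Q Z t) := by
  have hsum := hQ.1.continuousIntoL2_self.add (hQ.continuousIntoL2_sq_mul h0)
  have h1 : ∀ t : ℝ, 1 + t ^ 2 ≠ 0 := fun t => by positivity
  have hc : Continuous fun t : ℝ => ((t / (1 + t ^ 2) : ℝ) : ℂ) :=
    Complex.continuous_ofReal.comp (continuous_id.div (by fun_prop) h1)
  refine (hsum.weight_mul hc (C := 1) fun t => ?_).congr fun Z _ => ae_of_all _ fun t => ?_
  · rw [Complex.norm_real, Real.norm_eq_abs, abs_div, abs_of_pos (by positivity : 0 < 1 + t ^ 2)]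
    refine div_le_one_of_le₀ ?_ (by positivity)
    nlinarith [sq_nonneg (|t| - 1), sq_abs t, abs_nonneg t]
  · have : (1 + (t : ℂ) ^ 2) ≠ 0 := by exact_mod_cast h1 t
    push_cast
    field_simp

end flow

/-! ### Dilations on `L²`. -/

theorem memLp_comp_mul_left {f : ℝ → ℂ} (hf : MemLp f 2 volume) {a : ℝ} (ha : 0 < a) :
    MemLp (fun t => f (a * t)) 2 volume := by
  have h1 : MemLp f 2 (Measure.map (a * ·) volume) := by
    rw [Real.map_volume_mul_left ha.ne']
    exact hf.smul_measure ENNReal.ofReal_ne_top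
  exact h1.comp_of_map (measurable_const_mul a).aemeasurable

theorem l2_comp_mul_left_sq {f : ℝ → ℂ} (hf : MemLp f 2 volume) {a : ℝ} (ha : 0 < a) :
    l2 (fun t => f (a * t)) ^ 2 = a⁻¹ * l2 f ^ 2 := by
  rw [l2_sq (memLp_comp_mul_left hf ha), l2_sq hf,
    Measure.integral_comp_mul_left (fun t => ‖f t‖ ^ 2), abs_of_pos (inv_pos.2 ha), smul_eq_mul]

theorem l2_comp_mul_left {f : ℝ → ℂ} (hf : MemLp f 2 volume) {a : ℝ} (ha : 0 < a) :
    l2 (fun t => f (a * t)) = Real.sqrt a⁻¹ * l2 f := by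
  rw [← Real.sqrt_sq (l2_nonneg fun t => f (a * t)), l2_comp_mul_left_sq hf ha,
    Real.sqrt_mul (inv_pos.2 ha).le, Real.sqrt_sq (l2_nonneg f)]

theorem tendsto_l2_comp_mul_left_sub_of_hasCompactSupport {g : ℝ → ℂ} (hg : Continuous g)
    (hgc : HasCompactSupport g) {a₀ : ℝ} (ha₀ : 0 < a₀) :
    Tendsto (fun a => l2 (fun t => g (a * t) - g (a₀ * t))) (𝓝 a₀) (𝓝 0) := by
  have hg2 : MemLp g 2 volume := hg.memLp_of_hasCompactSupport hgc
  obtain ⟨M, hM⟩ := hgc.exists_bound_of_continuous hg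
  obtain ⟨R, hR⟩ := hgc.isCompact.isBounded.subset_closedBall 0
  have hz : ∀ t, |R| < |t| → g t = 0 := by
    intro t ht
    by_contra h0
    have := hR (subset_tsupport _ h0)
    rw [Metric.mem_closedBall, dist_zero_right, Real.norm_eq_abs] at this
    exact absurd ht (not_lt.2 (this.trans (le_abs_self R)))
  -- For `a > a₀ / 2` all the dilates vanish outside one interval of radius `2 |R| / a₀`, which
  -- supplies the dominating function.
  have hpos : ∀ᶠ a in 𝓝 a₀, a₀ / 2 < a := lt_mem_nhds (half_lt_self ha₀)
  have hsq : Tendsto (fun a => l2 (fun t => g (a * t) - g (a₀ * t)) ^ 2) (𝓝 a₀) (𝓝 0) := by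
    have hl : Tendsto (fun a => ∫ t, ‖g (a * t) - g (a₀ * t)‖ ^ 2) (𝓝 a₀) (𝓝 (∫ _ : ℝ, (0 : ℝ))) := by
      refine tendsto_integral_filter_of_dominated_convergence
        ((Set.Icc (-(2 * |R| / a₀)) (2 * |R| / a₀)).indicator fun _ => (2 * M) ^ 2) ?_ ?_ ?_ ?_
      · exact Eventually.of_forall fun a => Continuous.aestronglyMeasurable (by fun_prop)
      · filter_upwards [hpos] with a ha
        refine ae_of_all _ fun t => ?_
        rw [Real.norm_of_nonneg (sq_nonneg _)]
        by_cases ht : t ∈ Set.Icc (-(2 * |R| / a₀)) (2 * |R| / a₀)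
        · rw [Set.indicator_of_mem ht]
          refine pow_le_pow_left₀ (norm_nonneg _) ((norm_sub_le _ _).trans ?_) 2
          linarith [hM (a * t), hM (a₀ * t)]
        · rw [Set.indicator_of_notMem ht]
          have ht' : 2 * |R| / a₀ < |t| := by
            by_contra h
            exact ht (abs_le.1 (not_lt.1 h))
          rw [div_lt_iff₀ ha₀] at ht'
          have z1 : g (a * t) = 0 := hz _ (by
            rw [abs_mul, abs_of_pos ((half_pos ha₀).trans ha)]
            nlinarith [abs_nonneg t])
          have z2 : g (a₀ * t) = 0 := hz _ (by
            rw [abs_mul, abs_of_pos ha₀]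
            nlinarith [abs_nonneg t, abs_nonneg R])
          simp [z1, z2]
      · exact (integrable_indicator_iff measurableSet_Icc).2
          (integrableOn_const (by simp))
      · refine ae_of_all _ fun t => ?_
        have : Continuous fun a => ‖g (a * t) - g (a₀ * t)‖ ^ 2 := by fun_prop
        simpa using this.tendsto a₀
    rw [integral_zero] at hl
    refine hl.congr' ?_
    filter_upwards [hpos] with a ha
    exact (l2_sq ((memLp_comp_mul_left hg2 ((half_pos ha₀).trans ha)).sub
      (memLp_comp_mul_left hg2 ha₀))).symm
  have := hsq.sqrt
  simpa [Real.sqrt_sq (l2_nonneg _)] using this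

/-- Dilations act continuously on `L²`. -/
theorem tendsto_l2_comp_mul_left_sub {f : ℝ → ℂ} (hf : MemLp f 2 volume) {a₀ : ℝ} (ha₀ : 0 < a₀) :
    Tendsto (fun a => l2 (fun t => f (a * t) - f (a₀ * t))) (𝓝 a₀) (𝓝 0) := by
  rw [Metric.tendsto_nhds]
  intro η hη
  have hs : 0 ≤ Real.sqrt a₀⁻¹ := Real.sqrt_nonneg _
  obtain ⟨δ, hδ, hδη⟩ : ∃ δ : ℝ, 0 < δ ∧ (Real.sqrt a₀⁻¹ + 1) * δ + Real.sqrt a₀⁻¹ * δ < η / 2 := by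
    refine ⟨η / (4 * (2 * Real.sqrt a₀⁻¹ + 1)), by positivity, ?_⟩
    have h : (Real.sqrt a₀⁻¹ + 1) * (η / (4 * (2 * Real.sqrt a₀⁻¹ + 1)))
        + Real.sqrt a₀⁻¹ * (η / (4 * (2 * Real.sqrt a₀⁻¹ + 1))) = η / 4 := by
      field_simp
      ring
    rw [h]; linarith
  obtain ⟨g, hgc, hfg, hg, hg2⟩ := hf.exists_hasCompactSupport_eLpNorm_sub_le (by norm_num)
    (ENNReal.ofReal_pos.2 hδ).ne'
  have hfg' : l2 (f - g) ≤ δ := ENNReal.toReal_le_of_le_ofReal hδ.le hfg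
  have mfg : MemLp (f - g) 2 volume := hf.sub hg2
  have t1 : ∀ᶠ a in 𝓝 a₀, Real.sqrt a⁻¹ < Real.sqrt a₀⁻¹ + 1 := by
    have : ContinuousAt (fun a : ℝ => Real.sqrt a⁻¹) a₀ :=
      (continuousAt_inv₀ ha₀.ne').sqrt
    exact this.eventually (gt_mem_nhds (lt_add_one _))
  have t2 := (tendsto_l2_comp_mul_left_sub_of_hasCompactSupport hg hgc ha₀).eventually
    (gt_mem_nhds (half_pos hη))
  filter_upwards [t1, t2, lt_mem_nhds ha₀] with a h1 h2 ha
  rw [Real.dist_eq, sub_zero, abs_of_nonneg (l2_nonneg _)]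
  have b1 : l2 (fun t => (f - g) (a * t)) ≤ (Real.sqrt a₀⁻¹ + 1) * δ := by
    rw [l2_comp_mul_left mfg ha]
    exact mul_le_mul h1.le hfg' (l2_nonneg _) (by positivity)
  have b2 : l2 (fun t => (g - f) (a₀ * t)) ≤ Real.sqrt a₀⁻¹ * δ := by
    have : l2 (g - f) = l2 (f - g) := l2_sub_comm g f
    rw [l2_comp_mul_left (hg2.sub hf) ha₀, this]
    exact mul_le_mul_of_nonneg_left hfg' hs
  have m1 := memLp_comp_mul_left mfg ha
  have m2 := memLp_comp_mul_left (hg2.sub hf) ha₀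
  have m3 := (memLp_comp_mul_left hg2 ha).sub (memLp_comp_mul_left hg2 ha₀)
  have g1 := l2_add_le (m1.add m3) m2
  have g2 := l2_add_le m1 m3
  have e : (fun t => f (a * t) - f (a₀ * t)) = fun t => ((f - g) (a * t)
      + (g (a * t) - g (a₀ * t))) + (g - f) (a₀ * t) := by
    funext t; simp only [Pi.sub_apply]; ring
  rw [e]
  refine g1.trans_lt ((add_le_add_left g2 _).trans_lt ?_)
  have h2' : l2 ((fun t => g (a * t)) - fun t => g (a₀ * t)) < η / 2 := h2
  linarith

/-- The increment splits into a dilate of `F (ζ z) - F (ζ z₀)`, whose norm is rescaled by `(a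
z)^{-1/2}`, and the change of dilation on the fixed function `F (ζ z₀)`. -/
theorem ContinuousIntoL2.comp_dilation {I S : Set ℝ} {F : ℝ → ℝ → ℂ} (hF : ContinuousIntoL2 I F)
    {ζ a : ℝ → ℝ} (hζ : ContinuousOn ζ S) (hmaps : Set.MapsTo ζ S I) (ha : ContinuousOn a S)
    (hpos : ∀ z ∈ S, 0 < a z) : ContinuousIntoL2 S (fun z t => F (ζ z) (a z * t)) := by
  refine ⟨fun z hz => memLp_comp_mul_left (hF.1 _ (hmaps hz)) (hpos z hz), fun z₀ hz₀ => ?_⟩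
  have hζt : Tendsto ζ (𝓝[S] z₀) (𝓝[I] (ζ z₀)) :=
    tendsto_nhdsWithin_iff.2 ⟨hζ z₀ hz₀, by
      filter_upwards [self_mem_nhdsWithin] with z hz using hmaps hz⟩
  have l1 := (hF.2 _ (hmaps hz₀)).comp hζt
  have l2' := (tendsto_l2_comp_mul_left_sub (hF.1 _ (hmaps hz₀)) (hpos z₀ hz₀)).comp (ha z₀ hz₀)
  have l3 := ((ha z₀ hz₀).tendsto.inv₀ (hpos z₀ hz₀).ne').sqrt
  have hl := (l3.mul l1).add l2'
  rw [mul_zero, zero_add] at hl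
  refine squeeze_zero' (Eventually.of_forall fun _ => l2_nonneg _) ?_ hl
  filter_upwards [self_mem_nhdsWithin] with z hz
  have m0 : MemLp (fun t => F (ζ z) t - F (ζ z₀) t) 2 volume :=
    (hF.1 _ (hmaps hz)).sub (hF.1 _ (hmaps hz₀))
  have m1 := memLp_comp_mul_left m0 (hpos z hz)
  have m2 := (memLp_comp_mul_left (hF.1 _ (hmaps hz₀)) (hpos z hz)).sub
    (memLp_comp_mul_left (hF.1 _ (hmaps hz₀)) (hpos z₀ hz₀))
  have h := l2_add_le m1 m2
  rw [l2_comp_mul_left m0 (hpos z hz)] at h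
  refine le_trans (le_of_eq ?_) h
  congr 1; funext t; simp only [Pi.sub_apply]; ring

/-! ### The quadratic phase and the conclusion. -/

/-- The quadratic phase `e^{i C t² / 4}`. -/
noncomputable def chirp (C t : ℝ) : ℂ := Complex.exp (Complex.I * ((C / 4 * t ^ 2 : ℝ) : ℂ))

theorem norm_chirp (C t : ℝ) : ‖chirp C t‖ = 1 := by
  rw [chirp, mul_comm, Complex.norm_exp_ofReal_mul_I]

theorem hasDerivAt_chirp (C t : ℝ) :
    HasDerivAt (chirp C) (Complex.I * (C / 2 * t : ℂ) * chirp C t) t := by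
  have h1 : HasDerivAt (fun t : ℝ => C / 4 * t ^ 2) (C / 2 * t) t := by
    have h2 : HasDerivAt (fun t : ℝ => t ^ 2) (2 * t) t := by simpa using hasDerivAt_pow 2 t
    exact (h2.const_mul (C / 4)).congr_deriv (by ring)
  refine ((h1.ofReal_comp.const_mul Complex.I).cexp).congr_deriv ?_
  rw [chirp]; push_cast; ring

theorem hasDerivAt_chirp_deriv (C t : ℝ) :
    HasDerivAt (fun t : ℝ => Complex.I * (C / 2 * t : ℂ) * chirp C t)
      ((Complex.I * (C / 2) - (C / 2 * t) ^ 2 : ℂ) * chirp C t) t := by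
  have h1 : HasDerivAt (fun t : ℝ => Complex.I * (C / 2 * t : ℂ)) (Complex.I * (C / 2)) t := by
    have := ((hasDerivAt_id t).ofReal_comp.const_mul (C / 2 : ℂ)).const_mul Complex.I
    exact this.congr_deriv (by simp)
  refine (h1.mul (hasDerivAt_chirp C t)).congr_deriv ?_
  linear_combination ((C : ℂ) / 2 * t) ^ 2 * chirp C t * Complex.I_mul_I

theorem continuous_chirp (C : ℝ) : Continuous (chirp C) :=
  continuous_iff_continuousAt.2 fun t => (hasDerivAt_chirp C t).continuousAt

theorem continuous_zMap (C₂ : ℝ) : Continuous (zMap C₂) := by unfold zMap; fun_prop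

theorem transformed_eq (C₂ : ℝ) (Q : ℝ → ℝ → ℂ) (z : ℝ) :
    transformed C₂ Q z = fun t => Complex.exp (-((C₂ / 2 * z : ℝ) : ℂ)) *
      (chirp C₂ t * Q (zMap C₂ z) (Real.exp (-C₂ * z) * t)) := by
  funext t
  rw [transformed, tMap, sub_eq_add_neg, Complex.exp_add, chirp]
  ring

/-- The transformed function is continuous into `H²` as soon as `T² Q(0, T)` is in `L²`: by
interpolation, no separate decay assumption on `Q_T(0, ·)` is required. -/
theorem continuousIntoH_transformed {ρ L : ℝ} (C₂ : ℝ) {Q : ℝ → ℝ → ℂ}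
    (hQ : IsH2SolutionSNLSE ρ (Set.Icc 0 L) Q)
    (h0 : MemLp (fun T : ℝ => (T : ℂ) ^ 2 * Q 0 T) 2 volume) :
    ContinuousIntoH 2 (zMap C₂ ⁻¹' Set.Icc 0 L) (transformed C₂ Q) := by
  set S := zMap C₂ ⁻¹' Set.Icc 0 L
  set a : ℝ → ℝ := fun z => Real.exp (-C₂ * z)
  set c : ℝ → ℂ := fun z => Complex.exp (-((C₂ / 2 * z : ℝ) : ℂ))
  have ha0 : ∀ z, 0 < a z := fun z => Real.exp_pos _
  have hac : Continuous a := by fun_prop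
  have hcc : Continuous c := by fun_prop
  have hdil : ∀ {F : ℝ → ℝ → ℂ}, ContinuousIntoL2 (Set.Icc 0 L) F →
      ContinuousIntoL2 S fun z t => F (zMap C₂ z) (a z * t) := fun hF =>
    hF.comp_dilation (continuous_zMap C₂).continuousOn (fun _ hz => hz) hac.continuousOn
      fun z _ => ha0 z
  have hphase : ∀ {F : ℝ → ℝ → ℂ}, ContinuousIntoL2 S F →
      ContinuousIntoL2 S fun z t => c z * (chirp C₂ t * F z t) := fun hF =>
    (hF.weight_mul (continuous_chirp C₂) fun t => (norm_chirp C₂ t).le).smul hcc.continuousOn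
  have q0 := hdil hQ.1.continuousIntoL2_self
  have q1 := hdil (hQ.1.continuousIntoL2 one_le_two)
  have q2 := hdil (hQ.1.continuousIntoL2 le_rfl)
  have x0 := hdil (hQ.continuousIntoL2_id_mul h0)
  have x1 := hdil (hQ.continuousIntoL2_id_mul_weakDeriv h0)
  have xx := hdil (hQ.continuousIntoL2_sq_mul h0)
  have haC : Continuous fun z => (a z : ℂ) := Complex.continuous_ofReal.comp hac
  have haC0 : ∀ z, (a z : ℂ) ≠ 0 := fun z => by exact_mod_cast (ha0 z).ne'
  have hm : ∀ z ∈ S, MemH 2 (Q (zMap C₂ z)) := fun z hz => hQ.1.1 _ hz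
  have d1 : ∀ z ∈ S, IsWeakDeriv 1 (fun t => Q (zMap C₂ z) (a z * t))
      (fun t => (a z : ℂ) * weakDeriv 1 (Q (zMap C₂ z)) (a z * t)) := fun z hz => by
    simpa using ((hm z hz).isWeakDeriv one_le_two).comp_mul_left (ha0 z)
  have d2 : ∀ z ∈ S, IsWeakDeriv 2 (fun t => Q (zMap C₂ z) (a z * t))
      (fun t => (a z : ℂ) ^ 2 * weakDeriv 2 (Q (zMap C₂ z)) (a z * t)) := fun z hz =>
    ((hm z hz).isWeakDeriv le_rfl).comp_mul_left (ha0 z)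
  have hG1 : Continuous fun t : ℝ => Complex.I * (C₂ / 2 * t : ℂ) * chirp C₂ t :=
    continuous_iff_continuousAt.2 fun t => (hasDerivAt_chirp_deriv C₂ t).continuousAt
  have hG2 : Continuous fun t : ℝ => (Complex.I * (C₂ / 2) - (C₂ / 2 * t) ^ 2 : ℂ) * chirp C₂ t :=
    Continuous.mul (by fun_prop) (continuous_chirp C₂)
  refine continuousIntoH_of_isWeakDeriv fun k hk => ?_
  interval_cases k
  · refine ⟨transformed C₂ Q, fun z hz => ?_, ?_⟩
    · refine IsWeakDeriv.zero_order ?_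
      rw [transformed_eq]
      exact ((q0.1 z hz).locallyIntegrable (by norm_num)).continuous_mul (continuous_chirp C₂)
        |>.continuous_mul continuous_const
    · exact (hphase q0).congr fun z _ => by rw [transformed_eq]
  -- The dilated functions carry the weight `T = a t`, so the factor `t` coming from the phase is
  -- written `a⁻¹ T`.
  · refine ⟨_, fun z hz => ?_, hphase ((x0.smul (c := fun z => Complex.I * (C₂ / 2) * (a z : ℂ)⁻¹)
      (continuous_const.mul (haC.inv₀ haC0)).continuousOn).add (q1.smul haC.continuousOn))⟩
    rw [transformed_eq]
    refine (((d1 z hz).mul_smooth_one (hasDerivAt_chirp C₂) hG1).const_mul (c z)).congr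
      EventuallyEq.rfl (ae_of_all _ fun t => ?_)
    have := haC0 z
    push_cast
    field_simp
  -- Likewise `t² = a⁻² T²`. In the cross term the `a` from differentiating the dilation cancels the
  -- `a⁻¹`, leaving the constant `I * C₂`.
  · refine ⟨_, fun z hz => ?_, hphase (((q0.smul (c := fun _ => Complex.I * (C₂ / 2))
      continuousOn_const).add (xx.smul (c := fun z => -(C₂ / 2 * (a z : ℂ)⁻¹) ^ 2)
        (((continuous_const.mul (haC.inv₀ haC0)).pow 2).neg).continuousOn)).add
      ((x1.smul (c := fun _ => Complex.I * C₂) continuousOn_const).add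
        (q2.smul (c := fun z => (a z : ℂ) ^ 2) (haC.pow 2).continuousOn)))⟩
    rw [transformed_eq]
    refine (((d1 z hz).mul_smooth_two (d2 z hz) (hasDerivAt_chirp C₂) (hasDerivAt_chirp_deriv C₂)
      hG2).const_mul (c z)).congr EventuallyEq.rfl (ae_of_all _ fun t => ?_)
    have := haC0 z
    push_cast
    field_simp
    ring

end NLSE

theorem proposition3p3 (C₂ ρ L : ℝ) (hC₂ : 0 < C₂) (hρ : ρ = 1 ∨ ρ = -1) (hL : 0 < L)
    (Q : ℝ → ℝ → ℂ) (hQ : NLSE.IsH2SolutionSNLSE ρ (Set.Icc 0 L) Q)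
    (h0 : MemLp (fun T : ℝ => (T : ℂ) ^ 2 * Q 0 T) 2 volume)
    (h1 : MemLp (fun T : ℝ => ((|T| : ℝ) : ℂ) * NLSE.weakDeriv 1 (Q 0) T) 2 volume) :
    NLSE.ContinuousIntoH 2 (NLSE.zMap C₂ ⁻¹' Set.Icc 0 L) (NLSE.transformed C₂ Q) :=
  NLSE.continuousIntoH_transformed C₂ hQ h0
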